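/- Let $G\subset\mathbb{R}^d$ be a bounded domain with continuous boundary, i.e. a bounded, open, connected, non-empty set which near each boundary point is, in suitable Cartesian coordinates, the part below the graph of a continuous function (every bounded Lipschitz domain, e.g. a box, qualifies). Equip $\mathbb{R}^{k\times d}$ and $\mathbb{R}^{(k\times d)\times(k\times d)}$ with the Frobenius norms; a tensor $H$ acts on matrices by $(HD)_{ij}=\sum_{I,J}H_{ijIJ}D_{IJ}$, and $\mathcal S_{\ge\kappa}$ denotes the set of symmetric tensors $H$ ($H_{ijIJ}=H_{IJij}$) with $(HD):D\ge\kappa\, D:D$ for all $D\in\mathbb{R}^{k\times d}$. Let $$\mathcal H=\Big\{u\in L^2(G,\mathbb{R}^k):\int_G u\,dx=0\Big\},\qquad \mathcal V=H^1(G,\mathbb{R}^k)\cap\mathcal H,\qquad \langle\mathcal A(H)u,v\rangle=\int_G (H\nabla u):\nabla v\,dx\quad(u,v\in\mathcal V).$$ Let $\tau,c,\omega,\alpha>0$. Let $F:\mathbb{R}^{k\times d}\to\mathcal S_{\ge 0}$ be continuous and weakly differentiable, with $F$ and its weak Jacobian essentially bounded by $c$ (in the Frobenius norms), and assume $F(D)\in\mathcal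 S_{\ge\omega}$ for all $D\in\mathbb{R}^{k\times d}$. Let $u^0\in\mathcal V$ and $H^0\in L^\infty(G,\mathcal S_{\ge\alpha})$. Consider the problem $$\partial_t u+\mathcal A(H)u=0\ \text{ in } L^2(0,T;\mathcal V'),\qquad \tau\,\partial_t H+H-F(\nabla u)=0\ \text{ in } L^2(0,T;L^\infty(G)),\qquad u(0)=u^0,\quad H(0)=H^0. \qquad (*)$$ A pair $(u,H)$ is a strong solution of $(*)$ on $[0,T]$ if $H\in\mathcal S_{\ge\kappa}$ a.e. in $(0,T)\times G$ for some $\kappa>0$, $$u\in H^1(0,T;\mathcal V')\cap L^2(0,T;\mathcal V)\cap H^1(0,T;\mathcal H),\quad \operatorname{div}(H\nabla u)\in L^2(0,T;\mathcal H),\quad H\in H^1(0,T;L^\infty(G)),$$ and $(*)$ holds; $u$ and $H$ are identified with their continuous representatives with values in $L^2(G)$ and $L^\infty(G)$, respectively. It is a strong solution on $[0,\infty)$ if it is one on $[0,T]$ for every $T>0$. Put $$\mathcal E(t)=\frac12\int_G\|u(t,x)\|^2\,dx+\frac\tau2\int_G\|H(t,x)-F(0)\|^2\,dx .$$ Then there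 exist constants $C,\beta>0$, depending only on $d,k,G,\tau,c,\omega,\alpha$, such that for all $F,u^0,H^0$ as above and every strong solution $(u,H)$ of $(*)$ on $[0,\infty)$, $$\mathcal E(t)\le C e^{-2\beta t}\,\mathcal E(0)\qquad\text{for all } t\ge 0,$$ and consequently $$\lim_{t\to\infty}(u(t),H(t))=(0,F(0))\quad\text{in } L^2(G,\mathbb{R}^k)\times L^2\big(G,\mathbb{R}^{(k\times d)\times(k\times d)}\big).$$ -/

import Mathlib

open MeasureTheory Set Filter Topology
open scoped ENNReal

noncomputable section

namespace ColorDiffusion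

/-! ### Matrices and fourth-order tensors with their Frobenius norms -/

/-- `ℝ^d`. -/
abbrev Vec (d : ℕ) : Type := EuclideanSpace ℝ (Fin d)

/-- `ℝ^{k × d}` with the Frobenius norm. -/
abbrev Mat (k d : ℕ) : Type := EuclideanSpace ℝ (Fin k × Fin d)

/-- `ℝ^{(k × d) × (k × d)}` with the Frobenius norm. -/
abbrev Tensor (k d : ℕ) : Type := EuclideanSpace ℝ ((Fin k × Fin d) × (Fin k × Fin d))

/-- The matrix `H D`, with entries `(H D)_{ij} = ∑_{I,J} H_{ijIJ} D_{IJ}`. -/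
def Tensor.app {k d : ℕ} (H : Tensor k d) (D : Mat k d) : Mat k d :=
  WithLp.toLp 2 fun p => ∑ q, H (p, q) * D q

/-- The set `𝒮_{≥ κ}(ℝ^{k × d})` of symmetric tensors whose smallest eigenvalue is at least `κ`. -/
def symGE (k d : ℕ) (κ : ℝ) : Set (Tensor k d) :=
  {H | (∀ p q, H (p, q) = H (q, p)) ∧ ∀ D : Mat k d, κ * inner ℝ D D ≤ inner ℝ (H.app D) D}

/-! ### Test functions and weak derivatives -/

/-- `φ ∈ C_c^∞(Ω)`. -/
def IsTest {E : Type*} [NormedAddCommGroup E] [NormedSpace ℝ E] (Ω : Set E) (φ : E → ℝ) : Prop :=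
  ContDiff ℝ (⊤ : ℕ∞) φ ∧ HasCompactSupport φ ∧ tsupport φ ⊆ Ω

/-- The partial derivative `∂_b φ`. -/
def partialD {ι : Type*} [Fintype ι] [DecidableEq ι] (b : ι) (φ : EuclideanSpace ℝ ι → ℝ)
    (x : EuclideanSpace ℝ ι) : ℝ :=
  fderiv ℝ φ x (EuclideanSpace.single b 1)

/-- `D` is the weak Jacobian of `f` in `Ω`: `D_{ab} = ∂_b f_a` in the sense of distributions. -/
def IsWeakJacobian {ι κ : Type*} [Fintype ι] [DecidableEq ι] [Fintype κ]
    (Ω : Set (EuclideanSpace ℝ ι)) (f : EuclideanSpace ℝ ι → EuclideanSpace ℝ κ)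
    (D : EuclideanSpace ℝ ι → EuclideanSpace ℝ (κ × ι)) : Prop :=
  ∀ φ : EuclideanSpace ℝ ι → ℝ, IsTest Ω φ → ∀ (a : κ) (b : ι),
    ∫ x in Ω, partialD b φ x * f x a = - ∫ x in Ω, φ x * D x (a, b)

/-- `g = div J` in `Ω` in the sense of distributions, where the divergence is taken row by row. -/
def IsWeakDivergence {k d : ℕ} (Ω : Set (Vec d)) (J : Vec d → Mat k d) (g : Vec d → Vec k) : Prop :=
  ∀ φ : Vec d → ℝ, IsTest Ω φ → ∀ i : Fin k,
    ∫ x in Ω, φ x * g x i = - ∫ x in Ω, ∑ j : Fin d, partialD j φ x * J x (i, j)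

/-- `g` is the weak time derivative of the Banach space valued function `f` on `(0, T)`. -/
def IsWeakTimeDeriv {X : Type*} [NormedAddCommGroup X] [NormedSpace ℝ X] (T : ℝ) (f g : ℝ → X) :
    Prop :=
  ∀ φ : ℝ → ℝ, IsTest (Ioo 0 T) φ →
    ∫ t in Ioo 0 T, deriv φ t • f t = - ∫ t in Ioo 0 T, φ t • g t

/-- `f ∈ L²(0, T; X)` (Bochner space). -/
def MemL2Time {X : Type*} [NormedAddCommGroup X] (T : ℝ) (f : ℝ → X) : Prop :=
  MemLp f 2 (volume.restrict (Ioo 0 T))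

/-- `f ∈ H¹(0, T; X)` with weak derivative `g`. -/
def IsH1Time {X : Type*} [NormedAddCommGroup X] [NormedSpace ℝ X] (T : ℝ) (f g : ℝ → X) : Prop :=
  MemL2Time T f ∧ MemL2Time T g ∧ IsWeakTimeDeriv T f g

/-! ### The spatial domain -/

/-- A bounded domain of `ℝ^d` with continuous boundary: near each boundary point, in suitable
Cartesian coordinates, the domain is the part below the graph of a continuous function. -/
structure BoundedDomain (d : ℕ) where
  carrier : Set (Vec d)
  isOpen : IsOpen carrier
  isConnected : IsConnected carrier
  isBounded : Bornology.IsBounded carrier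
  boundary_graph : ∀ p ∈ frontier carrier, ∃ e : Vec d, ‖e‖ = 1 ∧ ∃ r > 0, ∃ h > 0,
    ∃ γ : Vec d → ℝ, Continuous γ ∧
      ∀ y : Vec d, inner ℝ y e = 0 → ‖y‖ < r → ∀ s : ℝ, |s| < h →
        (p + y + s • e ∈ carrier ↔ s < γ y)

variable {d : ℕ}

/-- Lebesgue measure on `G`. -/
abbrev BoundedDomain.vol (G : BoundedDomain d) : Measure (Vec d) := volume.restrict G.carrier

instance (G : BoundedDomain d) : IsFiniteMeasure G.vol :=
  ⟨by simpa using G.isBounded.measure_lt_top⟩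

/-! ### Function spaces on the domain -/

/-- `L²(G, ℝ^k)`. -/
abbrev L2Vec (G : BoundedDomain d) (k : ℕ) : Type := Lp (Vec k) 2 G.vol

/-- `L²(G, ℝ^{k × d})`. -/
abbrev L2Mat (G : BoundedDomain d) (k : ℕ) : Type := Lp (Mat k d) 2 G.vol

/-- `L^∞(G, ℝ^{(k × d) × (k × d)})`. -/
abbrev LinfTensor (G : BoundedDomain d) (k : ℕ) : Type := Lp (Tensor k d) ∞ G.vol

/-- `ℋ`: the subspace of functions in `L²(G, ℝ^k)` with zero mean. -/
def meanZero (G : BoundedDomain d) (k : ℕ) : Submodule ℝ (L2Vec G k) where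
  carrier := {u | ∫ x, u x ∂G.vol = 0}
  add_mem' := by
    intro u v hu hv
    have hu' := (Lp.memLp u).integrable one_le_two
    have hv' := (Lp.memLp v).integrable one_le_two
    simp only [Set.mem_ofPred_eq] at *
    rw [integral_congr_ae (Lp.coeFn_add u v)]
    simp only [Pi.add_apply]
    rw [integral_add hu' hv', hu, hv, add_zero]
  zero_mem' := by
    simp only [Set.mem_ofPred_eq]
    rw [integral_congr_ae (Lp.coeFn_zero _ _ _)]
    simp
  smul_mem' := by
    intro c u hu
    simp only [Set.mem_ofPred_eq] at *
    rw [integral_congr_ae (Lp.coeFn_smul c u)]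
    simp only [Pi.smul_apply]
    rw [integral_smul, hu, smul_zero]

theorem IsTest.memLp_partialD {ι : Type*} [Fintype ι] [DecidableEq ι]
    {Ω : Set (EuclideanSpace ℝ ι)} {φ : EuclideanSpace ℝ ι → ℝ} (hφ : IsTest Ω φ) (b : ι)
    (μ : Measure (EuclideanSpace ℝ ι)) [IsFiniteMeasure μ] : MemLp (partialD b φ) 2 μ := by
  have hc : Continuous (partialD b φ) :=
    (hφ.1.continuous_fderiv (by simp)).clm_apply continuous_const
  have hs : HasCompactSupport (partialD b φ) := hφ.2.1.fderiv_apply (𝕜 := ℝ) _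
  exact hc.memLp_of_hasCompactSupport hs

theorem memLp_coord {α κ : Type*} [MeasurableSpace α] [Fintype κ] {μ : Measure α}
    {f : α → EuclideanSpace ℝ κ} (hf : MemLp f 2 μ) (a : κ) : MemLp (fun x => f x a) 2 μ :=
  (EuclideanSpace.proj a : EuclideanSpace ℝ κ →L[ℝ] ℝ).comp_memLp' hf

/-- `𝒱 = H¹(G, ℝ^k) ∩ ℋ`, realised as the space of pairs `(u, ∇u)` with the norm
`(‖u‖² + ‖∇u‖²)^{1/2}`. -/
def sobolevV (G : BoundedDomain d) (k : ℕ) : Submodule ℝ (WithLp 2 (L2Vec G k × L2Mat G k)) where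
  carrier := {p | p.fst ∈ meanZero G k ∧ IsWeakJacobian G.carrier p.fst p.snd}
  add_mem' := by
    rintro p q ⟨hp, hp'⟩ ⟨hq, hq'⟩
    refine ⟨by simpa using (meanZero G k).add_mem hp hq, fun φ hφ a b => ?_⟩
    have hφ2 : MemLp φ 2 G.vol :=
      hφ.1.continuous.memLp_of_hasCompactSupport hφ.2.1
    have hd2 := hφ.memLp_partialD b G.vol
    have e1 : ∀ᵐ x ∂G.vol, partialD b φ x * (p + q).fst x a =
        partialD b φ x * p.fst x a + partialD b φ x * q.fst x a := by
      filter_upwards [Lp.coeFn_add p.fst q.fst] with x hx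
      rw [WithLp.add_fst, hx, Pi.add_apply, PiLp.add_apply, mul_add]
    have e2 : ∀ᵐ x ∂G.vol, φ x * (p + q).snd x (a, b) =
        φ x * p.snd x (a, b) + φ x * q.snd x (a, b) := by
      filter_upwards [Lp.coeFn_add p.snd q.snd] with x hx
      rw [WithLp.add_snd, hx, Pi.add_apply, PiLp.add_apply, mul_add]
    have i1 : ∀ r : WithLp 2 (L2Vec G k × L2Mat G k),
        Integrable (fun x => partialD b φ x * r.fst x a) G.vol := fun r =>
      hd2.integrable_mul (memLp_coord (Lp.memLp r.fst) a)
    have i2 : ∀ r : WithLp 2 (L2Vec G k × L2Mat G k),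
        Integrable (fun x => φ x * r.snd x (a, b)) G.vol := fun r =>
      hφ2.integrable_mul (memLp_coord (Lp.memLp r.snd) (a, b))
    rw [integral_congr_ae e1, integral_congr_ae e2, integral_add (i1 p) (i1 q),
      integral_add (i2 p) (i2 q), hp' φ hφ a b, hq' φ hφ a b, neg_add]
  zero_mem' := by
    refine ⟨by simp, fun φ hφ a b => ?_⟩
    have e1 : ∀ᵐ x ∂G.vol, partialD b φ x *
        (0 : WithLp 2 (L2Vec G k × L2Mat G k)).fst x a = 0 := by
      filter_upwards [Lp.coeFn_zero (Vec k) 2 G.vol] with x hx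
      rw [WithLp.zero_fst, hx]; simp
    have e2 : ∀ᵐ x ∂G.vol, φ x *
        (0 : WithLp 2 (L2Vec G k × L2Mat G k)).snd x (a, b) = 0 := by
      filter_upwards [Lp.coeFn_zero (Mat k d) 2 G.vol] with x hx
      rw [WithLp.zero_snd, hx]; simp
    rw [integral_congr_ae e1, integral_congr_ae e2]; simp
  smul_mem' := by
    rintro c p ⟨hp, hp'⟩
    refine ⟨by simpa using (meanZero G k).smul_mem c hp, fun φ hφ a b => ?_⟩
    have e1 : ∀ᵐ x ∂G.vol, partialD b φ x * (c • p).fst x a =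
        c * (partialD b φ x * p.fst x a) := by
      filter_upwards [Lp.coeFn_smul c p.fst] with x hx
      rw [WithLp.smul_fst, hx, Pi.smul_apply, PiLp.smul_apply, smul_eq_mul]; ring
    have e2 : ∀ᵐ x ∂G.vol, φ x * (c • p).snd x (a, b) =
        c * (φ x * p.snd x (a, b)) := by
      filter_upwards [Lp.coeFn_smul c p.snd] with x hx
      rw [WithLp.smul_snd, hx, Pi.smul_apply, PiLp.smul_apply, smul_eq_mul]; ring
    rw [integral_congr_ae e1, integral_congr_ae e2, integral_const_mul, integral_const_mul,
      hp' φ hφ a b, mul_neg]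

variable {G : BoundedDomain d} {k : ℕ}

/-- The function `u ∈ L²(G, ℝ^k)` underlying an element of `𝒱`. -/
def toL2 (v : sobolevV G k) : L2Vec G k := (v : WithLp 2 (L2Vec G k × L2Mat G k)).fst

/-- The gradient `∇u ∈ L²(G, ℝ^{k × d})` of an element of `𝒱`. -/
def grad (v : sobolevV G k) : L2Mat G k := (v : WithLp 2 (L2Vec G k × L2Mat G k)).snd

/-- The embedding of `L²(G, ℝ^k)` (in particular of `ℋ`) into `𝒱'`, `u ↦ (v ↦ ⟨u, v⟩_{L²})`. -/
def toDual (u : L2Vec G k) : StrongDual ℝ (sobolevV G k) :=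
  (innerSL ℝ u) ∘L (ContinuousLinearMap.fst ℝ (L2Vec G k) (L2Mat G k)) ∘L
    (WithLp.prodContinuousLinearEquiv 2 ℝ (L2Vec G k) (L2Mat G k)).toContinuousLinearMap ∘L
      (sobolevV G k).subtypeL

theorem toDual_apply (u : L2Vec G k) (v : sobolevV G k) : toDual u v = inner ℝ u (toL2 v) := rfl

/-- The bilinear form `a(u, v; H) = ∫_G (H ∇u) : ∇v dx`, so that
`⟨𝒜(H) u, v⟩ = a(u, v; H)`. -/
def form (H : LinfTensor G k) (u v : sobolevV G k) : ℝ :=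
  ∫ x, inner ℝ ((H x).app (grad u x)) (grad v x) ∂G.vol

/-! ### The response function and the solution notions -/

/-- `F : ℝ^{k × d} → 𝒮_{≥ 0}(ℝ^{k × d})` is weakly differentiable, and `F` and its weak Jacobian are
essentially bounded by `c`. Since `F` is evaluated at individual points and on gradients, `F` is
its continuous representative. -/
def IsResponse (c : ℝ) (F : Mat k d → Tensor k d) : Prop :=
  Continuous F ∧ (∀ D, F D ∈ symGE k d 0) ∧ (∀ᵐ D, ‖F D‖ ≤ c) ∧
    ∃ J : Mat k d → EuclideanSpace ℝ (((Fin k × Fin d) × (Fin k × Fin d)) × (Fin k × Fin d)),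
      AEStronglyMeasurable J volume ∧ (∀ᵐ D, ‖J D‖ ≤ c) ∧ IsWeakJacobian univ F J

/-- `(u, H)` is a weak solution on `[0, T]` of
`∂_t u + 𝒜(H) u = 0` in `L²(0, T; 𝒱')`, `τ ∂_t H + H - F(∇u) = 0` in `L²(0, T; L^∞)`,
`u(0) = u⁰`, `H(0) = H⁰`, where `u ∈ H¹(0, T; 𝒱') ∩ L²(0, T; 𝒱) ⊂ C([0, T]; ℋ)` and
`H ∈ H¹(0, T; L^∞) ⊂ C([0, T]; L^∞)` are represented by their continuous versions. -/
def IsWeakSolution (G : BoundedDomain d) (k : ℕ) (τ : ℝ) (F : Mat k d → Tensor k d)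
    (u₀ : L2Vec G k) (H₀ : LinfTensor G k) (T : ℝ)
    (u : ℝ → L2Vec G k) (H : ℝ → LinfTensor G k) : Prop :=
  ContinuousOn u (Icc 0 T) ∧ ContinuousOn H (Icc 0 T) ∧ u 0 = u₀ ∧ H 0 = H₀ ∧
  (∃ κ > 0, ∀ᵐ t ∂volume.restrict (Ioo 0 T), ∀ᵐ x ∂G.vol, H t x ∈ symGE k d κ) ∧
  ∃ (v : ℝ → sobolevV G k) (w : ℝ → StrongDual ℝ (sobolevV G k)) (H' : ℝ → LinfTensor G k),
    MemL2Time T v ∧ (∀ᵐ t ∂volume.restrict (Ioo 0 T), u t = toL2 (v t)) ∧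
    IsH1Time T (fun t => toDual (u t)) w ∧
    IsH1Time T H H' ∧
    (∀ᵐ t ∂volume.restrict (Ioo 0 T), ∀ z : sobolevV G k, w t z + form (H t) (v t) z = 0) ∧
    (∀ᵐ t ∂volume.restrict (Ioo 0 T), ∀ᵐ x ∂G.vol,
      τ • H' t x + H t x - F (grad (v t) x) = 0)

/-- A weak solution is strong if moreover `u ∈ H¹(0, T; ℋ)` and `div(H ∇u) ∈ L²(0, T; ℋ)`. -/
def IsStrongSolution (G : BoundedDomain d) (k : ℕ) (τ : ℝ) (F : Mat k d → Tensor k d)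
    (u₀ : L2Vec G k) (H₀ : LinfTensor G k) (T : ℝ)
    (u : ℝ → L2Vec G k) (H : ℝ → LinfTensor G k) : Prop :=
  IsWeakSolution G k τ F u₀ H₀ T u H ∧
  (∃ u' : ℝ → L2Vec G k, IsH1Time T u u' ∧
    ∀ᵐ t ∂volume.restrict (Ioo 0 T), u t ∈ meanZero G k ∧ u' t ∈ meanZero G k) ∧
  ∃ g : ℝ → L2Vec G k, MemL2Time T g ∧
    ∀ᵐ t ∂volume.restrict (Ioo 0 T), g t ∈ meanZero G k ∧
      ∃ z : sobolevV G k, toL2 z = u t ∧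
        IsWeakDivergence G.carrier (fun x => (H t x).app (grad z x)) (g t)

/-- A strong solution on `[0, ∞)`. -/
def IsGlobalStrongSolution (G : BoundedDomain d) (k : ℕ) (τ : ℝ) (F : Mat k d → Tensor k d)
    (u₀ : L2Vec G k) (H₀ : LinfTensor G k)
    (u : ℝ → L2Vec G k) (H : ℝ → LinfTensor G k) : Prop :=
  ∀ T > 0, IsStrongSolution G k τ F u₀ H₀ T u H

/-- `½ ∫_G ‖u‖² dx + (τ/2) ∫_G ‖H - F(0)‖² dx`. -/
def energy (τ : ℝ) (F : Mat k d → Tensor k d) (u : L2Vec G k) (H : LinfTensor G k) : ℝ :=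
  1 / 2 * ∫ x, ‖u x‖ ^ 2 ∂G.vol + τ / 2 * ∫ x, ‖H x - F 0‖ ^ 2 ∂G.vol

end ColorDiffusion

end

open ColorDiffusion

/-!
The energy decays because the gradient of `u` dissipates and controls everything else.

Testing the equation of `u` with `u` itself gives `½ d/dt ‖u‖² = -∫ (H ∇u) : ∇u`, and the relaxation
equation gives `(τ/2) d/dt ‖H - F(0)‖² = -‖H - F(0)‖² + ⟪H - F(0), F(∇u) - F(0)⟫`. Three facts turn
this into exponential decay.

* `H(t)` is a convex combination of `H⁰` and of values of `F`, so it stays coercive with constant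
  `κ = min α ω` (`IsGlobalStrongSolution.coercive`). Hence the first line dissipates at least
  `κ ‖∇u‖²`.
* A continuous function with bounded weak Jacobian is Lipschitz (`IsWeakJacobian.norm_sub_le`), so
  the forcing `F(∇u) - F(0)` has norm at most `c ‖∇u‖`. In `lam ‖u‖² + τ ‖H - F(0)‖²`, with a weight
  `lam ≥ c² / κ`, it is absorbed by the dissipation.
* The Poincaré inequality `‖u‖² ≤ C ‖∇u‖²` on `𝒱` (`BoundedDomain.exists_norm_toL2_sq_le`) turns
  what is left of the dissipation into a multiple of the weighted energy, and Grönwall's inequality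
  concludes (`IsGlobalStrongSolution.weighted_energy_le`).

All statements about weak derivatives rest on one identity, `IsWeakDerivAlong.ae_sub_eq_integral`: a
function with a weak derivative in the direction `v` satisfies `f(x + v) - f(x) = ∫₀¹ g(x + t v) dt`
for almost every `x` whose segment stays in the domain. It gives the Lipschitz bound for `F`, the
representation of an `H¹` function of time as a primitive, and a translation estimate
`‖f(· + v) - f‖ ≤ |v| ‖∇f‖` in `L²`.

The Poincaré inequality is deduced from the translation estimate, without a compactness theorem for
Sobolev spaces. Integrated over the increments between two points of a fixed ball, the estimate
bounds the distance of `f` to a constant on that ball. It also lets the control of the `L²` norm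
spread from the ball along segments: to all interior points by connectedness, and to a neighbourhood
of every boundary point by pushing the part of the domain below the graph downwards. Compactness of
the closure of the domain then leaves finitely many such neighbourhoods.
-/

noncomputable section

namespace ColorDiffusion

/-! ### Weak directional derivatives and translations -/

section Translation

variable {E X : Type*} [NormedAddCommGroup E] [NormedSpace ℝ E] [FiniteDimensional ℝ E]
  [MeasurableSpace E] [BorelSpace E] {μ : Measure E} [μ.IsAddHaarMeasure]
  [NormedAddCommGroup X] [NormedSpace ℝ X]

/-- `g` is the weak derivative of `f` in `Ω` in the direction `v`. -/
def IsWeakDerivAlong (μ : Measure E) (Ω : Set E) (v : E) (f g : E → X) : Prop :=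
  ∀ φ : E → ℝ, IsTest Ω φ →
    ∫ x in Ω, fderiv ℝ φ x v • f x ∂μ = - ∫ x in Ω, φ x • g x ∂μ

omit [FiniteDimensional ℝ E] [MeasurableSpace E] [BorelSpace E] in
theorem IsTest.comp_sub {Ω U : Set E} {φ : E → ℝ} (hφ : IsTest U φ) (w : E)
    (h : ∀ x ∈ U, x + w ∈ Ω) : IsTest Ω fun x => φ (x - w) := by
  have hc : HasCompactSupport fun x => φ (x - w) :=
    hφ.2.1.comp_homeomorph (Homeomorph.subRight w)
  refine ⟨hφ.1.comp (contDiff_id.sub contDiff_const), hc, ?_⟩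
  have : tsupport (fun x => φ (x - w)) ⊆ (fun x => x - w) ⁻¹' tsupport φ :=
    tsupport_comp_subset_preimage φ (by fun_prop)
  intro x hx
  have h1 := h _ (hφ.2.2 (this hx))
  simpa using h1

omit [FiniteDimensional ℝ E] [MeasurableSpace E] [BorelSpace E] in
theorem isOpen_setOf_segment_subset {Ω : Set E} (hΩ : IsOpen Ω) (v : E) :
    IsOpen {x : E | ∀ t ∈ Icc (0 : ℝ) 1, x + t • v ∈ Ω} := by
  rw [isOpen_iff_mem_nhds]
  intro x hx
  refine isCompact_Icc.eventually_forall_of_forall_eventually ?_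
  intro t ht
  have hc : Continuous fun z : E × ℝ => z.1 + z.2 • v := by fun_prop
  exact hc.continuousAt.eventually_mem (hΩ.mem_nhds (hx t ht))

omit [NormedSpace ℝ X] in
theorem integrable_comp_shear {g : E → X} (hg : Integrable g μ) (v : E)
    (ν : Measure ℝ) [IsFiniteMeasure ν] :
    Integrable (fun p : ℝ × E => g (p.2 + p.1 • v)) (ν.prod μ) := by
  have hs : MeasurePreserving (fun p : ℝ × E => (p.1, p.2 + p.1 • v)) (ν.prod μ) (ν.prod μ) := by
    refine (MeasurePreserving.id ν).skew_product (g := fun t x => x + t • v) ?_ ?_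
    · exact Measurable.add measurable_snd (measurable_fst.smul_const v)
    · exact Eventually.of_forall fun t => (measurePreserving_add_right μ (t • v)).map_eq
  exact (hs.integrable_comp_of_integrable (hg.comp_snd ν) :)

/-- The increment along `v` of a function with a weak derivative in the direction `v` is almost
everywhere the integral of this derivative along the segment, if the segment stays in the domain.
Tested against `φ`, the right-hand side is an average over `t` of integrals of `g` against the
translate `φ (· - t v)`, which is a test function of the domain; there the derivative is moved onto
`φ` and integrates to `φ (· - v) - φ`. -/
theorem IsWeakDerivAlong.ae_sub_eq_integral [CompleteSpace X] {Ω : Set E} (hΩ : IsOpen Ω) {v : E}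
    {f g : E → X} (hf : IntegrableOn f Ω μ) (hg : IntegrableOn g Ω μ)
    (h : IsWeakDerivAlong μ Ω v f g) :
    ∀ᵐ x ∂μ, (∀ t ∈ Icc (0 : ℝ) 1, x + t • v ∈ Ω) →
      f (x + v) - f x = ∫ t in Ioc (0 : ℝ) 1, g (x + t • v) := by
  set U : Set E := {x : E | ∀ t ∈ Icc (0 : ℝ) 1, x + t • v ∈ Ω} with hU
  have hUo : IsOpen U := isOpen_setOf_segment_subset hΩ v
  -- Extended by zero, the functions are integrable on the whole space and may be translated.
  set F : E → X := Ω.indicator f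
  set K : E → X := Ω.indicator g
  have hF : Integrable F μ := (integrable_indicator_iff hΩ.measurableSet).2 hf
  have hK : Integrable K μ := (integrable_indicator_iff hΩ.measurableSet).2 hg
  set ν : Measure ℝ := volume.restrict (Ioc 0 1)
  have hKs := integrable_comp_shear hK v ν
  have hFv : Integrable (fun x => F (x + v)) μ := hF.comp_add_right v
  have hKi : Integrable (fun x => ∫ t, K (x + t • v) ∂ν) μ := hKs.integral_prod_right
  have key : ∀ᵐ x ∂μ, x ∈ U → F (x + v) - F x - ∫ t, K (x + t • v) ∂ν = 0 := by
    have hQ : Integrable (fun x => F (x + v) - F x - ∫ t, K (x + t • v) ∂ν) μ :=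
      (hFv.sub hF).sub hKi
    refine hUo.ae_eq_zero_of_integral_contDiff_smul_eq_zero
      (hQ.locallyIntegrable.locallyIntegrableOn _) ?_
    intro φ hφ hφc hφU
    have hφt : IsTest U φ := ⟨hφ, hφc, hφU⟩
    have hcont : Continuous φ := hφ.continuous
    obtain ⟨M, hM⟩ := hφc.exists_bound_of_continuous hcont
    have hdc : Continuous fun x => fderiv ℝ φ x v :=
      (hφ.continuous_fderiv (by simp)).clm_apply continuous_const
    obtain ⟨M', hM'⟩ := (hφc.fderiv_apply (𝕜 := ℝ) v).exists_bound_of_continuous hdc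
    have i1 : Integrable (fun x => φ x • F (x + v)) μ :=
      hFv.bdd_smul M hcont.aestronglyMeasurable (Eventually.of_forall hM)
    have i2 : Integrable (fun x => φ x • F x) μ :=
      hF.bdd_smul M hcont.aestronglyMeasurable (Eventually.of_forall hM)
    have i3 : Integrable (fun x => φ x • ∫ t, K (x + t • v) ∂ν) μ :=
      hKi.bdd_smul M hcont.aestronglyMeasurable (Eventually.of_forall hM)
    have i4 : Integrable (fun x => φ (x - v) • F x) μ :=
      hF.bdd_smul M (by fun_prop) (Eventually.of_forall fun x => hM _)
    have e1 : ∫ x, φ x • F (x + v) ∂μ = ∫ x, φ (x - v) • F x ∂μ := by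
      rw [← integral_add_right_eq_self (fun x => φ (x - v) • F x) v]
      simp
    have e3 : ∀ t ∈ Ioc (0 : ℝ) 1, ∫ x, φ x • K (x + t • v) ∂μ =
        - ∫ x, fderiv ℝ φ (x - t • v) v • F x ∂μ := by
      intro t ht
      have ht' := hφt.comp_sub (Ω := Ω) (t • v) fun x hx => hx t ⟨ht.1.le, ht.2⟩
      have := h _ ht'
      have hfd : ∀ x, fderiv ℝ (fun x => φ (x - t • v)) x v = fderiv ℝ φ (x - t • v) v := by
        intro x
        rw [fderiv_comp_sub (f := φ)]
      simp only [hfd] at this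
      rw [← integral_indicator hΩ.measurableSet, ← integral_indicator hΩ.measurableSet] at this
      have hi : ∀ (a : E → ℝ) (b : E → X), Ω.indicator (fun x => a x • b x) =
          fun x => a x • Ω.indicator b x := fun a b => by
        ext x; by_cases hx : x ∈ Ω <;> simp [hx]
      rw [hi, hi] at this
      rw [← integral_add_right_eq_self (fun x => φ (x - t • v) • K x) (t • v)] at this
      rw [this]
      simp [K]
    have e4 : ∫ x, φ x • (∫ t, K (x + t • v) ∂ν) ∂μ =
        ∫ x, (φ (x - v) - φ x) • F x ∂μ := by
      have j1 : Integrable (fun p : ℝ × E => φ p.2 • K (p.2 + p.1 • v)) (ν.prod μ) :=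
        hKs.bdd_smul M (by fun_prop) (Eventually.of_forall fun x => hM _)
      have j2 : Integrable (fun p : ℝ × E => fderiv ℝ φ (p.2 - p.1 • v) v • F p.2) (ν.prod μ) :=
        (hF.comp_snd ν).bdd_smul M'
          (hdc.comp (by fun_prop : Continuous fun p : ℝ × E => p.2 - p.1 • v)).aestronglyMeasurable
          (Eventually.of_forall fun x => hM' _)
      calc ∫ x, φ x • (∫ t, K (x + t • v) ∂ν) ∂μ
          = ∫ x, ∫ t, φ x • K (x + t • v) ∂ν ∂μ := by simp only [integral_smul]
        _ = ∫ t, ∫ x, φ x • K (x + t • v) ∂μ ∂ν := (integral_integral_swap j1).symm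
        _ = ∫ t, - ∫ x, fderiv ℝ φ (x - t • v) v • F x ∂μ ∂ν :=
          setIntegral_congr_fun measurableSet_Ioc e3
        _ = - ∫ x, ∫ t, fderiv ℝ φ (x - t • v) v • F x ∂ν ∂μ := by
          rw [integral_neg, integral_integral_swap j2]
        _ = ∫ x, (φ (x - v) - φ x) • F x ∂μ := by
          rw [← integral_neg]
          refine integral_congr_ae (Eventually.of_forall fun x => ?_)
          simp only
          rw [integral_smul_const, ← neg_smul]
          congr 1
          have hd : ∀ t ∈ uIcc (0 : ℝ) 1, HasDerivAt (fun t : ℝ => -φ (x - t • v))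
              (fderiv ℝ φ (x - t • v) v) t := by
            intro t _
            have h1 : HasDerivAt (fun t : ℝ => x - t • v) (-v) t := by
              simpa using ((hasDerivAt_id t).smul_const v).const_sub x
            have h2 := ((hφ.differentiable (by simp)) (x - t • v)).hasFDerivAt.comp_hasDerivAt t h1
            exact (h2.neg).congr_deriv (by simp)
          have := intervalIntegral.integral_eq_sub_of_hasDerivAt hd
            ((hdc.comp (by fun_prop : Continuous fun t : ℝ => x - t • v)).intervalIntegrable _ _)
          rw [intervalIntegral.integral_of_le zero_le_one] at this
          refine Eq.trans (congrArg _ this) ?_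
          simp [sub_eq_neg_add, add_comm]
    simp only [smul_sub]
    have i5 : Integrable (fun x => φ x • F (x + v) - φ x • F x) μ := i1.sub i2
    rw [integral_sub i5 i3, integral_sub i1 i2, e1, e4]
    simp only [sub_smul]
    rw [integral_sub i4 i2, sub_self]
  filter_upwards [key] with x hx hxU
  have h0 : x ∈ Ω := by simpa using hxU 0 (by simp)
  have h1 : x + v ∈ Ω := by simpa using hxU 1 (by simp)
  have h2 := hx hxU
  simp only [F, indicator_of_mem h0, indicator_of_mem h1] at h2
  rw [sub_eq_zero.1 h2]
  refine setIntegral_congr_fun measurableSet_Ioc fun t ht => ?_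
  exact indicator_of_mem (hxU t ⟨ht.1.le, ht.2⟩) _

theorem enorm_integral_sq_le_lintegral_sq {α : Type*} [MeasurableSpace α] {ν : Measure α}
    [IsProbabilityMeasure ν] {g : α → X} (hg : AEStronglyMeasurable g ν) :
    ‖∫ t, g t ∂ν‖ₑ ^ 2 ≤ ∫⁻ t, ‖g t‖ₑ ^ 2 ∂ν := by
  have h1 : ‖∫ t, g t ∂ν‖ₑ ≤ eLpNorm g 2 ν := by
    refine (enorm_integral_le_lintegral_enorm g).trans ?_
    rw [← eLpNorm_one_eq_lintegral_enorm]
    exact eLpNorm_le_eLpNorm_of_exponent_le one_le_two hg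
  calc ‖∫ t, g t ∂ν‖ₑ ^ 2 ≤ eLpNorm g 2 ν ^ 2 := by gcongr
    _ = ∫⁻ t, ‖g t‖ₑ ^ 2 ∂ν := by
      have := eLpNorm_nnreal_pow_eq_lintegral (f := g) (μ := ν) (p := 2) two_ne_zero
      norm_cast at this ⊢
      exact_mod_cast this

/-- The `L²` norm of a difference of translates is bounded by that of the weak directional
derivative. -/
theorem IsWeakDerivAlong.lintegral_sub_sq_le [CompleteSpace X] {Ω : Set E} (hΩ : IsOpen Ω) {v : E}
    {f g : E → X} (hf : IntegrableOn f Ω μ) (hg : IntegrableOn g Ω μ)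
    (h : IsWeakDerivAlong μ Ω v f g) {A : Set E}
    (hA : ∀ x ∈ A, ∀ t ∈ Icc (0 : ℝ) 1, x + t • v ∈ Ω) :
    ∫⁻ x in A, ‖f (x + v) - f x‖ₑ ^ 2 ∂μ ≤ ∫⁻ x in Ω, ‖g x‖ₑ ^ 2 ∂μ := by
  set U : Set E := {x : E | ∀ t ∈ Icc (0 : ℝ) 1, x + t • v ∈ Ω} with hU
  have hUo : IsOpen U := isOpen_setOf_segment_subset hΩ v
  set K : E → X := Ω.indicator g
  have hK : Integrable K μ := (integrable_indicator_iff hΩ.measurableSet).2 hg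
  set ν : Measure ℝ := volume.restrict (Ioc 0 1)
  have : IsProbabilityMeasure ν := ⟨by simp [ν]⟩
  have hKs := integrable_comp_shear hK v ν
  have hm : AEMeasurable (fun p : ℝ × E => ‖K (p.2 + p.1 • v)‖ₑ ^ 2) (ν.prod μ) :=
    hKs.aestronglyMeasurable.enorm.pow_const 2
  calc ∫⁻ x in A, ‖f (x + v) - f x‖ₑ ^ 2 ∂μ ≤ ∫⁻ x in U, ‖f (x + v) - f x‖ₑ ^ 2 ∂μ :=
        lintegral_mono_set hA
    _ ≤ ∫⁻ x in U, ∫⁻ t, ‖K (x + t • v)‖ₑ ^ 2 ∂ν ∂μ := by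
        refine setLIntegral_mono_ae' hUo.measurableSet ?_
        filter_upwards [h.ae_sub_eq_integral hΩ hf hg, hKs.prod_left_ae] with x hx hx' hxU
        rw [hx hxU]
        have : ∫ t in Ioc (0 : ℝ) 1, g (x + t • v) = ∫ t, K (x + t • v) ∂ν :=
          setIntegral_congr_fun measurableSet_Ioc fun t ht =>
            (indicator_of_mem (hxU t ⟨ht.1.le, ht.2⟩) _).symm
        rw [this]
        exact enorm_integral_sq_le_lintegral_sq hx'.aestronglyMeasurable
    _ ≤ ∫⁻ x, ∫⁻ t, ‖K (x + t • v)‖ₑ ^ 2 ∂ν ∂μ := setLIntegral_le_lintegral _ _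
    _ = ∫⁻ t, ∫⁻ x, ‖K (x + t • v)‖ₑ ^ 2 ∂μ ∂ν := (lintegral_lintegral_swap hm).symm
    _ = ∫⁻ x in Ω, ‖g x‖ₑ ^ 2 ∂μ := by
        have : ∀ t : ℝ, ∫⁻ x, ‖K (x + t • v)‖ₑ ^ 2 ∂μ = ∫⁻ x in Ω, ‖g x‖ₑ ^ 2 ∂μ := by
          intro t
          rw [lintegral_add_right_eq_self (fun x => ‖K x‖ₑ ^ 2) (t • v),
            ← lintegral_indicator hΩ.measurableSet]
          refine lintegral_congr fun x => ?_
          by_cases hx : x ∈ Ω <;> simp [K, hx]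
        simp [this]

end Translation

/-! ### Weak Jacobians -/

section Jacobian

variable {ι κ : Type*} [Fintype ι] [DecidableEq ι] [Fintype κ]

/-- The product of the matrix `M` with the vector `v`. -/
def matMul (M : EuclideanSpace ℝ (κ × ι)) (v : EuclideanSpace ℝ ι) : EuclideanSpace ℝ κ :=
  WithLp.toLp 2 fun a => ∑ b, v b * M (a, b)

omit [DecidableEq ι] in
theorem norm_matMul_le (M : EuclideanSpace ℝ (κ × ι)) (v : EuclideanSpace ℝ ι) :
    ‖matMul M v‖ ≤ ‖v‖ * ‖M‖ := by
  refine abs_le_of_sq_le_sq' ?_ (by positivity) |>.2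
  rw [mul_pow, EuclideanSpace.real_norm_sq_eq, EuclideanSpace.real_norm_sq_eq,
    EuclideanSpace.real_norm_sq_eq, Fintype.sum_prod_type, Finset.mul_sum]
  exact Finset.sum_le_sum fun a _ => Finset.sum_mul_sq_le_sq_mul_sq _ _ _

/-- The product with `v` as a continuous linear map. -/
def matMulL (v : EuclideanSpace ℝ ι) :
    EuclideanSpace ℝ (κ × ι) →L[ℝ] EuclideanSpace ℝ κ :=
  LinearMap.mkContinuous
    { toFun := fun M => matMul M v
      map_add' := fun M N => by
        ext a; simp [matMul, mul_add, Finset.sum_add_distrib]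
      map_smul' := fun r M => by
        ext a; simp only [matMul, PiLp.smul_apply, smul_eq_mul, RingHom.id_apply, Finset.mul_sum]
        exact Finset.sum_congr rfl fun b _ => by ring }
    ‖v‖ fun M => norm_matMul_le M v

omit [DecidableEq ι] in
@[simp] theorem matMulL_apply (v : EuclideanSpace ℝ ι) (M : EuclideanSpace ℝ (κ × ι)) :
    matMulL v M = matMul M v := rfl

theorem IsTest.integrable_smul {E X : Type*} [NormedAddCommGroup E] [NormedSpace ℝ E]
    [MeasurableSpace E] [OpensMeasurableSpace E] [NormedAddCommGroup X] [NormedSpace ℝ X]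
    {μ : Measure E} {Ω : Set E} {φ : E → ℝ} (hφ : IsTest Ω φ) {f : E → X}
    (hf : Integrable f μ) : Integrable (fun x => φ x • f x) μ := by
  obtain ⟨M, hM⟩ := hφ.2.1.exists_bound_of_continuous hφ.1.continuous
  exact hf.bdd_smul M hφ.1.continuous.aestronglyMeasurable (Eventually.of_forall hM)

theorem IsTest.integrable_fderiv_smul {E X : Type*} [NormedAddCommGroup E] [NormedSpace ℝ E]
    [MeasurableSpace E] [OpensMeasurableSpace E] [NormedAddCommGroup X] [NormedSpace ℝ X]
    {μ : Measure E} {Ω : Set E} {φ : E → ℝ} (hφ : IsTest Ω φ) {f : E → X} (v : E)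
    (hf : Integrable f μ) : Integrable (fun x => fderiv ℝ φ x v • f x) μ := by
  have hdc : Continuous fun x => fderiv ℝ φ x v :=
    (hφ.1.continuous_fderiv (by simp)).clm_apply continuous_const
  obtain ⟨M, hM⟩ := (hφ.2.1.fderiv_apply (𝕜 := ℝ) v).exists_bound_of_continuous hdc
  exact hf.bdd_smul M hdc.aestronglyMeasurable (Eventually.of_forall hM)

theorem IsWeakJacobian.isWeakDerivAlong {Ω : Set (EuclideanSpace ℝ ι)}
    {f : EuclideanSpace ℝ ι → EuclideanSpace ℝ κ}
    {D : EuclideanSpace ℝ ι → EuclideanSpace ℝ (κ × ι)}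
    (h : IsWeakJacobian Ω f D) (hf : IntegrableOn f Ω) (hD : IntegrableOn D Ω)
    (v : EuclideanSpace ℝ ι) :
    IsWeakDerivAlong volume Ω v f fun x => matMul (D x) v := by
  intro φ hφ
  have hDv : IntegrableOn (fun x => matMul (D x) v) Ω :=
    (matMulL (κ := κ) v).integrable_comp hD
  ext a
  have p1 := (EuclideanSpace.proj a : EuclideanSpace ℝ κ →L[ℝ] ℝ).integral_comp_comm
    (hφ.integrable_fderiv_smul v hf)
  have p2 := (EuclideanSpace.proj a : EuclideanSpace ℝ κ →L[ℝ] ℝ).integral_comp_comm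
    (hφ.integrable_smul hDv)
  simp only [EuclideanSpace.coe_proj, PiLp.smul_apply, smul_eq_mul] at p1 p2
  rw [PiLp.neg_apply, ← p1, ← p2]
  have hfa : IntegrableOn (fun x => f x a) Ω :=
    (EuclideanSpace.proj a : EuclideanSpace ℝ κ →L[ℝ] ℝ).integrable_comp hf
  have hDa : ∀ b, IntegrableOn (fun x => D x (a, b)) Ω := fun b =>
    (EuclideanSpace.proj (a, b) : EuclideanSpace ℝ (κ × ι) →L[ℝ] ℝ).integrable_comp hD
  have hv : v = ∑ b, v b • EuclideanSpace.single b (1 : ℝ) := by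
    ext c; simp [Finset.sum_apply, Pi.single_apply]
  have e1 : ∀ x, fderiv ℝ φ x v * f x a = ∑ b, v b * (partialD b φ x * f x a) := by
    intro x
    conv_lhs => rw [hv]
    simp only [map_sum, map_smul, smul_eq_mul, partialD, Finset.sum_mul, mul_assoc]
  have e2 : ∀ x, φ x * matMul (D x) v a = ∑ b, v b * (φ x * D x (a, b)) := by
    intro x
    simp only [matMul, Finset.mul_sum]
    exact Finset.sum_congr rfl fun b _ => by ring
  simp only [e1, e2]
  rw [integral_finsetSum, integral_finsetSum, ← Finset.sum_neg_distrib]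
  · refine Finset.sum_congr rfl fun b _ => ?_
    rw [integral_const_mul, integral_const_mul, h φ hφ a b, mul_neg]
  · exact fun b _ => (hφ.integrable_smul (hDa b)).const_mul _
  · exact fun b _ => (hφ.integrable_fderiv_smul _ hfa).const_mul _

theorem IsTest.mono {E : Type*} [NormedAddCommGroup E] [NormedSpace ℝ E] {Ω Ω' : Set E}
    {φ : E → ℝ} (hφ : IsTest Ω φ) (h : Ω ⊆ Ω') : IsTest Ω' φ :=
  ⟨hφ.1, hφ.2.1, hφ.2.2.trans h⟩

theorem IsWeakJacobian.mono {Ω Ω' : Set (EuclideanSpace ℝ ι)}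
    {f : EuclideanSpace ℝ ι → EuclideanSpace ℝ κ}
    {D : EuclideanSpace ℝ ι → EuclideanSpace ℝ (κ × ι)}
    (h : IsWeakJacobian Ω' f D) (hΩ : Ω ⊆ Ω') (hm' : MeasurableSet Ω') :
    IsWeakJacobian Ω f D := by
  intro φ hφ a b
  have := h φ (hφ.mono hΩ) a b
  have z1 : ∀ x ∉ Ω, φ x = 0 := fun x hx =>
    image_eq_zero_of_notMem_tsupport fun hx' => hx (hφ.2.2 hx')
  have z2 : ∀ x ∉ Ω, partialD b φ x = 0 := fun x hx => by
    have : fderiv ℝ φ x = 0 :=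
      image_eq_zero_of_notMem_tsupport fun hx' => hx (hφ.2.2 (tsupport_fderiv_subset ℝ hx'))
    simp [partialD, this]
  rw [setIntegral_eq_of_subset_of_forall_sdiff_eq_zero hm' hΩ,
    setIntegral_eq_of_subset_of_forall_sdiff_eq_zero hm' hΩ] at this
  · exact this
  · intro x hx; simp [z1 x hx.2]
  · intro x hx; simp [z2 x hx.2]

/-- A continuous function with bounded weak Jacobian is Lipschitz continuous. -/
theorem IsWeakJacobian.norm_sub_le {F : EuclideanSpace ℝ ι → EuclideanSpace ℝ κ}
    {J : EuclideanSpace ℝ ι → EuclideanSpace ℝ (κ × ι)} {c : ℝ} (h : IsWeakJacobian univ F J)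
    (hF : Continuous F) (hJ : AEStronglyMeasurable J volume) (hc : ∀ᵐ x, ‖J x‖ ≤ c)
    (x y : EuclideanSpace ℝ ι) : ‖F x - F y‖ ≤ c * ‖x - y‖ := by
  set v := x - y with hv
  set R : ℝ := ‖x‖ + ‖y‖ + 1
  set Ω : Set (EuclideanSpace ℝ ι) := Metric.ball 0 R
  have hΩ : IsOpen Ω := Metric.isOpen_ball
  have : IsFiniteMeasure (volume.restrict Ω) := ⟨by simpa using measure_ball_lt_top⟩
  have hFΩ : IntegrableOn F Ω :=
    (hF.continuousOn.integrableOn_compact (isCompact_closedBall 0 R)).mono_set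
      Metric.ball_subset_closedBall
  have hJΩ : IntegrableOn J Ω :=
    Integrable.of_bound hJ.restrict c (ae_restrict_of_ae hc)
  have hw := ((h.mono (subset_univ Ω) .univ).isWeakDerivAlong hFΩ hJΩ v).ae_sub_eq_integral
    hΩ hFΩ ((matMulL v).integrable_comp hJΩ)
  -- Almost every segment in the direction `v` meets the null set where `‖J‖ > c` in a null set.
  have hs : ∀ᵐ z : EuclideanSpace ℝ ι, ∀ᵐ t ∂volume.restrict (Ioc (0 : ℝ) 1),
      ‖J (z + t • v)‖ ≤ c := by
    have hq : Measure.QuasiMeasurePreserving (fun p : EuclideanSpace ℝ ι × ℝ => p.1 + p.2 • v)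
        (volume.prod (volume.restrict (Ioc (0 : ℝ) 1))) volume := by
      refine ⟨by fun_prop, Measure.AbsolutelyContinuous.mk fun s hs hs0 => ?_⟩
      have hmeas : Measurable fun p : EuclideanSpace ℝ ι × ℝ => p.1 + p.2 • v := by fun_prop
      rw [Measure.map_apply hmeas hs, Measure.prod_apply_symm (hmeas hs)]
      refine lintegral_eq_zero_of_ae_eq_zero (Eventually.of_forall fun t => ?_)
      have := measure_preimage_add_right (volume : Measure (EuclideanSpace ℝ ι)) (t • v) s
      rw [hs0] at this; exact this
    exact Measure.ae_ae_of_ae_prod (hq.ae hc)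
  set U : Set (EuclideanSpace ℝ ι) := {z | ∀ t ∈ Icc (0 : ℝ) 1, z + t • v ∈ Ω} with hU
  have hUo : IsOpen U := isOpen_setOf_segment_subset hΩ v
  have hae : ∀ᵐ z, z ∈ U → ‖F (z + v) - F z‖ ≤ c * ‖v‖ := by
    filter_upwards [hw, hs] with z hz hz' hzU
    rw [hz hzU]
    have := norm_setIntegral_le_of_norm_le_const_ae' (μ := volume) (s := Ioc (0 : ℝ) 1)
      (f := fun t => matMul (J (z + t • v)) v) (C := c * ‖v‖) (by simp)
      ((ae_restrict_iff' measurableSet_Ioc).1 (hz'.mono fun t ht => by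
        refine (norm_matMul_le _ _).trans ?_
        rw [mul_comm]; gcongr))
    simpa using this
  -- By continuity, a failure at `y` would be a failure on an open set.
  by_contra! hlt
  have hopen : IsOpen (U ∩ {z | c * ‖v‖ < ‖F (z + v) - F z‖}) :=
    hUo.inter (isOpen_lt (by fun_prop) (by fun_prop))
  have hy : y ∈ U ∩ {z | c * ‖v‖ < ‖F (z + v) - F z‖} := by
    refine ⟨fun t ht => ?_, by simpa [hv] using hlt⟩
    rw [mem_ball_zero_iff]
    have e : y + t • v = (1 - t) • y + t • x := by rw [hv]; module
    rw [e]
    calc ‖(1 - t) • y + t • x‖ ≤ ‖(1 - t) • y‖ + ‖t • x‖ := norm_add_le _ _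
      _ = (1 - t) * ‖y‖ + t * ‖x‖ := by
        rw [norm_smul, norm_smul, Real.norm_of_nonneg ht.1,
          Real.norm_of_nonneg (by linarith [ht.2])]
      _ < R := by
        have := mul_le_of_le_one_left (norm_nonneg x) ht.2
        have := mul_le_of_le_one_left (norm_nonneg y) (by linarith [ht.1] : 1 - t ≤ 1)
        simp only [R]; linarith
  refine (hopen.measure_pos volume ⟨y, hy⟩).ne' (measure_mono_null ?_ (ae_iff.1 hae))
  intro z hz
  simp only [mem_ofPred_eq, not_forall, not_le]
  exact ⟨hz.1, hz.2⟩

end Jacobian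

/-! ### The Poincaré inequality on bounded domains with continuous boundary -/

section Poincare

variable {ι κ : Type*} [Fintype ι] [DecidableEq ι] [Fintype κ]

/-- `f ∈ H¹(Ω)` with weak Jacobian `D`, both represented by measurable functions on the whole
space. -/
structure IsH1 (Ω : Set (EuclideanSpace ℝ ι)) (f : EuclideanSpace ℝ ι → EuclideanSpace ℝ κ)
    (D : EuclideanSpace ℝ ι → EuclideanSpace ℝ (κ × ι)) : Prop where
  measurable : Measurable f
  measurable_jacobian : Measurable D
  memLp : MemLp f 2 (volume.restrict Ω)
  memLp_jacobian : MemLp D 2 (volume.restrict Ω)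
  isWeakJacobian : IsWeakJacobian Ω f D

/-- The `L²` norm on `A` of an `H¹` function on `Ω` is bounded by its `L²` norm on `B` and the
`L²` norm of its gradient on `Ω`, uniformly in the function. -/
def IsControlled (κ : Type*) [Fintype κ] (Ω B A : Set (EuclideanSpace ℝ ι)) : Prop :=
  ∃ C : ℝ≥0∞, C ≠ ∞ ∧ ∀ (f : EuclideanSpace ℝ ι → EuclideanSpace ℝ κ)
    (D : EuclideanSpace ℝ ι → EuclideanSpace ℝ (κ × ι)), IsH1 Ω f D →
      ∫⁻ x in A, ‖f x‖ₑ ^ 2 ≤ C * ((∫⁻ x in B, ‖f x‖ₑ ^ 2) + ∫⁻ x in Ω, ‖D x‖ₑ ^ 2)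

variable {Ω B A A' : Set (EuclideanSpace ℝ ι)}

theorem IsH1.lintegral_sub_sq_le (hΩ : IsOpen Ω) (hΩf : volume Ω ≠ ∞)
    {f : EuclideanSpace ℝ ι → EuclideanSpace ℝ κ}
    {D : EuclideanSpace ℝ ι → EuclideanSpace ℝ (κ × ι)} (h : IsH1 Ω f D)
    {v : EuclideanSpace ℝ ι} (hA : ∀ x ∈ A, ∀ t ∈ Icc (0 : ℝ) 1, x + t • v ∈ Ω) :
    ∫⁻ x in A, ‖f (x + v) - f x‖ₑ ^ 2 ≤ ‖v‖ₑ ^ 2 * ∫⁻ x in Ω, ‖D x‖ₑ ^ 2 := by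
  have : IsFiniteMeasure (volume.restrict Ω) := ⟨by simpa using hΩf.lt_top⟩
  have hf : IntegrableOn f Ω := h.memLp.integrable one_le_two
  have hD : IntegrableOn D Ω := h.memLp_jacobian.integrable one_le_two
  refine ((h.isWeakJacobian.isWeakDerivAlong hf hD v).lintegral_sub_sq_le hΩ hf
    ((matMulL (κ := κ) v).integrable_comp hD) hA).trans ?_
  rw [← lintegral_const_mul _ (h.measurable_jacobian.enorm.pow_const 2)]
  refine lintegral_mono fun x => ?_
  simp only
  rw [← mul_pow]
  gcongr
  have h1 := norm_matMul_le (D x) v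
  rw [← ofReal_norm, ← ofReal_norm, ← ofReal_norm, ← ENNReal.ofReal_mul (norm_nonneg _)]
  exact ENNReal.ofReal_le_ofReal h1

theorem enorm_sq_le_two_mul {X : Type*} [SeminormedAddCommGroup X] (a b : X) :
    ‖b‖ₑ ^ 2 ≤ 2 * (‖a‖ₑ ^ 2 + ‖a - b‖ₑ ^ 2) := by
  have h : ‖b‖ ^ 2 ≤ 2 * (‖a‖ ^ 2 + ‖a - b‖ ^ 2) := by
    have h1 : ‖b‖ ≤ ‖a‖ + ‖a - b‖ := by
      calc ‖b‖ = ‖a - (a - b)‖ := by congr 1; abel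
        _ ≤ _ := norm_sub_le _ _
    nlinarith [sq_nonneg (‖a‖ - ‖a - b‖), norm_nonneg b]
  have := ENNReal.ofReal_le_ofReal h
  rw [ENNReal.ofReal_mul zero_le_two, ENNReal.ofReal_add (by positivity) (by positivity),
    ENNReal.ofReal_pow (norm_nonneg _), ENNReal.ofReal_pow (norm_nonneg _),
    ENNReal.ofReal_pow (norm_nonneg _), ofReal_norm, ofReal_norm, ofReal_norm] at this
  simpa using this

theorem IsControlled.mono (h : IsControlled κ Ω B A') (hA : A ⊆ A') : IsControlled κ Ω B A := by
  obtain ⟨C, hC, h⟩ := h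
  exact ⟨C, hC, fun f D hf => (lintegral_mono_set hA).trans (h f D hf)⟩

theorem IsControlled.union (h : IsControlled κ Ω B A) (h' : IsControlled κ Ω B A') :
    IsControlled κ Ω B (A ∪ A') := by
  obtain ⟨C, hC, h⟩ := h
  obtain ⟨C', hC', h'⟩ := h'
  refine ⟨C + C', ENNReal.add_ne_top.2 ⟨hC, hC'⟩, fun f D hf => ?_⟩
  rw [add_mul]
  exact (lintegral_union_le _ _ _).trans (add_le_add (h f D hf) (h' f D hf))

/-- Control spreads along translations whose segments stay in the domain. -/
theorem IsControlled.of_translate (hΩ : IsOpen Ω) (hΩf : volume Ω ≠ ∞)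
    (h : IsControlled κ Ω B A') (hA' : MeasurableSet A') {v : EuclideanSpace ℝ ι}
    (hv : ∀ x ∈ A, x + v ∈ A') (hA : ∀ x ∈ A, ∀ t ∈ Icc (0 : ℝ) 1, x + t • v ∈ Ω) :
    IsControlled κ Ω B A := by
  obtain ⟨C, hC, h⟩ := h
  refine ⟨2 * (C + ‖v‖ₑ ^ 2), by finiteness, fun f D hf => ?_⟩
  have h1 : ∫⁻ x in A, ‖f (x + v)‖ₑ ^ 2 ≤ ∫⁻ x in A', ‖f x‖ₑ ^ 2 := by
    calc ∫⁻ x in A, ‖f (x + v)‖ₑ ^ 2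
        ≤ ∫⁻ x in (fun x => x + v) ⁻¹' A', ‖f (x + v)‖ₑ ^ 2 := lintegral_mono_set hv
      _ = ∫⁻ x in A', ‖f x‖ₑ ^ 2 :=
        (measurePreserving_add_right volume v).setLIntegral_comp_preimage hA'
          (hf.measurable.enorm.pow_const 2)
  have hm : Measurable fun x => ‖f (x + v)‖ₑ ^ 2 :=
    (hf.measurable.comp (measurable_add_const v)).enorm.pow_const 2
  calc ∫⁻ x in A, ‖f x‖ₑ ^ 2
      ≤ ∫⁻ x in A, 2 * (‖f (x + v)‖ₑ ^ 2 + ‖f (x + v) - f x‖ₑ ^ 2) :=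
        lintegral_mono fun x => enorm_sq_le_two_mul _ _
    _ = 2 * ((∫⁻ x in A, ‖f (x + v)‖ₑ ^ 2) + ∫⁻ x in A, ‖f (x + v) - f x‖ₑ ^ 2) := by
        rw [lintegral_const_mul' _ _ (by simp), lintegral_add_left hm]
    _ ≤ 2 * (C * ((∫⁻ x in B, ‖f x‖ₑ ^ 2) + ∫⁻ x in Ω, ‖D x‖ₑ ^ 2) +
          ‖v‖ₑ ^ 2 * ∫⁻ x in Ω, ‖D x‖ₑ ^ 2) := by
        gcongr
        · exact h1.trans (h f D hf)
        · exact hf.lintegral_sub_sq_le hΩ hΩf hA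
    _ ≤ 2 * (C * ((∫⁻ x in B, ‖f x‖ₑ ^ 2) + ∫⁻ x in Ω, ‖D x‖ₑ ^ 2) +
          ‖v‖ₑ ^ 2 * ((∫⁻ x in B, ‖f x‖ₑ ^ 2) + ∫⁻ x in Ω, ‖D x‖ₑ ^ 2)) := by
        gcongr; exact le_add_self
    _ = _ := by ring

/-- On a ball, the mean square difference of the values of an `H¹` function is controlled by its
gradient: by Fubini's theorem the differences may be ordered by their increment `x - y`. -/
theorem IsH1.lintegral_lintegral_ball_le (hΩ : IsOpen Ω) (hΩf : volume Ω ≠ ∞)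
    {f : EuclideanSpace ℝ ι → EuclideanSpace ℝ κ}
    {D : EuclideanSpace ℝ ι → EuclideanSpace ℝ (κ × ι)} (h : IsH1 Ω f D)
    {b : EuclideanSpace ℝ ι} {r : ℝ} (hB : Metric.ball b r ⊆ Ω) :
    ∫⁻ y in Metric.ball b r, ∫⁻ x in Metric.ball b r, ‖f x - f y‖ₑ ^ 2 ≤
      ENNReal.ofReal (2 * r) ^ 2 * volume (Metric.ball (0 : EuclideanSpace ℝ ι) (2 * r)) *
        ∫⁻ x in Ω, ‖D x‖ₑ ^ 2 := by
  set S := Metric.ball b r with hS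
  have hSm : MeasurableSet S := Metric.isOpen_ball.measurableSet
  set I := ∫⁻ x in Ω, ‖D x‖ₑ ^ 2
  have hfm := h.measurable
  have hmS : Measurable fun p : EuclideanSpace ℝ ι × EuclideanSpace ℝ ι =>
      ‖f (p.1 + p.2) - f p.1‖ₑ ^ 2 := by fun_prop
  have hset : MeasurableSet
      {p : EuclideanSpace ℝ ι × EuclideanSpace ℝ ι | p.1 ∈ S ∧ p.1 + p.2 ∈ S} :=
    (measurable_fst hSm).inter ((measurable_fst.add measurable_snd) hSm)
  set K : EuclideanSpace ℝ ι × EuclideanSpace ℝ ι → ℝ≥0∞ :=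
    {p : EuclideanSpace ℝ ι × EuclideanSpace ℝ ι | p.1 ∈ S ∧ p.1 + p.2 ∈ S}.indicator
      fun p => ‖f (p.1 + p.2) - f p.1‖ₑ ^ 2 with hK
  have hKm : Measurable K := hmS.indicator hset
  have e1 : ∫⁻ y in S, ∫⁻ x in S, ‖f x - f y‖ₑ ^ 2 = ∫⁻ y, ∫⁻ v, K (y, v) := by
    rw [← lintegral_indicator hSm]
    refine lintegral_congr fun y => ?_
    by_cases hy : y ∈ S
    · rw [indicator_of_mem hy, ← lintegral_indicator hSm,
        ← lintegral_add_left_eq_self _ y]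
      refine lintegral_congr fun v => ?_
      by_cases hv : y + v ∈ S <;> simp [hK, hy, hv]
    · simp [hK, hy]
  rw [e1, lintegral_lintegral_swap (f := fun y v => K (y, v)) hKm.aemeasurable]
  calc ∫⁻ v, ∫⁻ y, K (y, v)
      ≤ ∫⁻ v, (Metric.ball (0 : EuclideanSpace ℝ ι) (2 * r)).indicator
          (fun _ => ENNReal.ofReal (2 * r) ^ 2 * I) v := by
        refine lintegral_mono fun v => ?_
        by_cases hv : v ∈ Metric.ball (0 : EuclideanSpace ℝ ι) (2 * r)
        · rw [indicator_of_mem hv]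
          have hsub : ∀ x ∈ {y | y ∈ S ∧ y + v ∈ S}, ∀ t ∈ Icc (0 : ℝ) 1, x + t • v ∈ Ω :=
            fun x hx t ht => hB ((convex_ball b r).add_smul_mem hx.1 hx.2 ht)
          have hm : MeasurableSet {y | y ∈ S ∧ y + v ∈ S} :=
            hSm.inter ((measurable_add_const v) hSm)
          calc ∫⁻ y, K (y, v) = ∫⁻ y in {y | y ∈ S ∧ y + v ∈ S}, ‖f (y + v) - f y‖ₑ ^ 2 := by
                rw [← lintegral_indicator hm]
                rfl
            _ ≤ ‖v‖ₑ ^ 2 * I := h.lintegral_sub_sq_le hΩ hΩf hsub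
            _ ≤ ENNReal.ofReal (2 * r) ^ 2 * I := by
                gcongr
                rw [← ofReal_norm]
                exact ENNReal.ofReal_le_ofReal (mem_ball_zero_iff.1 hv).le
        · rw [indicator_of_notMem hv]
          refine (lintegral_eq_zero_of_ae_eq_zero (Eventually.of_forall fun y => ?_)).le
          refine indicator_of_notMem (fun hy => hv ?_) _
          have h1 := mem_ball_iff_norm.1 hy.1
          have h2 := mem_ball_iff_norm.1 hy.2
          rw [mem_ball_zero_iff]
          calc ‖v‖ = ‖(y + v - b) - (y - b)‖ := by congr 1; abel
            _ ≤ ‖y + v - b‖ + ‖y - b‖ := norm_sub_le _ _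
            _ < 2 * r := by simp only at h1 h2; linarith
    _ = _ := by
        rw [lintegral_indicator Metric.isOpen_ball.measurableSet, setLIntegral_const]
        ring

theorem IsH1.sub_const (hΩf : volume Ω ≠ ∞) {f : EuclideanSpace ℝ ι → EuclideanSpace ℝ κ}
    {D : EuclideanSpace ℝ ι → EuclideanSpace ℝ (κ × ι)} (h : IsH1 Ω f D)
    (c : EuclideanSpace ℝ κ) : IsH1 Ω (fun x => f x - c) D := by
  have : IsFiniteMeasure (volume.restrict Ω) := ⟨by simpa using hΩf.lt_top⟩
  refine ⟨h.measurable.sub_const c, h.measurable_jacobian, h.memLp.sub (memLp_const c),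
    h.memLp_jacobian, fun φ hφ a b => ?_⟩
  rw [← h.isWeakJacobian φ hφ a b]
  have hd : Integrable (partialD b φ) (volume.restrict Ω) :=
    (hφ.memLp_partialD b _).integrable one_le_two
  have i1 : Integrable (fun x => partialD b φ x * f x a) (volume.restrict Ω) :=
    (hφ.memLp_partialD b _).integrable_mul (memLp_coord h.memLp a)
  have hz : ∫ x in Ω, partialD b φ x = 0 := by
    rw [setIntegral_eq_integral_of_forall_compl_eq_zero]
    · have hd0 : Integrable (fun x => fderiv ℝ φ x (EuclideanSpace.single b 1)) :=
        Continuous.integrable_of_hasCompactSupport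
          ((hφ.1.continuous_fderiv (by simp)).clm_apply continuous_const)
          (hφ.2.1.fderiv_apply (𝕜 := ℝ) _)
      have := integral_mul_fderiv_eq_neg_fderiv_mul_of_integrable
        (μ := (volume : Measure (EuclideanSpace ℝ ι))) (f := fun _ => (1 : ℝ)) (g := φ)
        (v := EuclideanSpace.single b 1) (by simp) (by simpa using hd0)
        (by simpa using hφ.1.continuous.integrable_of_hasCompactSupport hφ.2.1)
        (by fun_prop) (fun x _ => hφ.1.differentiable (by simp) x)
      simpa [partialD] using this
    · intro x hx
      have : fderiv ℝ φ x = 0 :=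
        image_eq_zero_of_notMem_tsupport fun hx' => hx (hφ.2.2 (tsupport_fderiv_subset ℝ hx'))
      simp [partialD, this]
  simp only [PiLp.sub_apply, mul_sub]
  rw [integral_sub i1 (hd.mul_const _), integral_mul_const, hz]
  simp

end Poincare

section Domain

variable {d : ℕ} {κ : Type*} [Fintype κ]

theorem BoundedDomain.volume_ne_top (G : BoundedDomain d) : volume G.carrier ≠ ∞ :=
  G.isBounded.measure_lt_top.ne

/-- Every interior point has a controlled neighbourhood: the set of such points is open, and it is
closed in the domain since small balls may be translated. -/
theorem BoundedDomain.exists_isControlled_ball (G : BoundedDomain d) {b : Vec d} {r : ℝ}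
    (hr : 0 < r) (hb : b ∈ G.carrier) {x : Vec d} (hx : x ∈ G.carrier) :
    ∃ δ > 0, IsControlled κ G.carrier (Metric.ball b r) (Metric.ball x δ) := by
  set S : Set (Vec d) := {x | ∃ δ > 0, IsControlled κ G.carrier (Metric.ball b r) (Metric.ball x δ)}
  have hS : IsOpen S := by
    rw [Metric.isOpen_iff]
    rintro y ⟨δ, hδ, hy⟩
    refine ⟨δ, hδ, fun z hz => ⟨δ - dist z y, sub_pos.2 hz, hy.mono ?_⟩⟩
    exact Metric.ball_subset_ball' (by linarith)
  refine G.isConnected.isPreconnected.subset_of_closure_inter_subset hS ⟨b, hb, r, hr, ?_⟩ ?_ hx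
  · exact ⟨1, by simp, fun f D _ => by rw [one_mul]; exact le_self_add⟩
  rintro y ⟨hyS, hyG⟩
  obtain ⟨ρ, hρ, hρG⟩ := Metric.isOpen_iff.1 G.isOpen y hyG
  obtain ⟨z, ⟨δ, hδ, hz⟩, hyz⟩ := Metric.mem_closure_iff.1 hyS (ρ / 2) (half_pos hρ)
  refine ⟨min δ (ρ / 2), lt_min hδ (half_pos hρ),
    hz.of_translate (v := z - y) G.isOpen G.volume_ne_top Metric.isOpen_ball.measurableSet ?_ ?_⟩
  · intro w hw
    have h1 := mem_ball_iff_norm.1 hw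
    rw [mem_ball_iff_norm]
    calc ‖w + (z - y) - z‖ = ‖w - y‖ := by congr 1; abel
      _ < δ := h1.trans_le (min_le_left _ _)
  · intro w hw t ht
    have h1 := (mem_ball_iff_norm.1 hw).trans_le (min_le_right _ _)
    have h2 : ‖z - y‖ < ρ / 2 := by rwa [← dist_eq_norm, dist_comm]
    refine hρG (mem_ball_iff_norm.2 ?_)
    calc ‖w + t • (z - y) - y‖ = ‖(w - y) + t • (z - y)‖ := by congr 1; abel
      _ ≤ ‖w - y‖ + ‖t • (z - y)‖ := norm_add_le _ _
      _ ≤ ‖w - y‖ + ‖z - y‖ := by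
        rw [norm_smul, Real.norm_of_nonneg ht.1]
        gcongr
        exact mul_le_of_le_one_left (norm_nonneg _) ht.2
      _ < ρ := by linarith

/-- Near a boundary point, the domain is pushed downwards into a controlled ball along segments
below the graph. -/
theorem BoundedDomain.exists_isControlled_frontier (G : BoundedDomain d) {b : Vec d} {r : ℝ}
    (hr : 0 < r) (hb : b ∈ G.carrier) {p : Vec d} (hp : p ∈ frontier G.carrier) :
    ∃ ρ > 0, IsControlled κ G.carrier (Metric.ball b r) (Metric.ball p ρ ∩ G.carrier) := by
  obtain ⟨e, he, R, hR, h, hh, γ, hγ, hG⟩ := G.boundary_graph p hp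
  -- The orthogonal decomposition of a point relative to `p` and the axis `e`.
  have hdec : ∀ z : Vec d, ∃ y : Vec d, ∃ s : ℝ, z = p + y + s • e ∧ inner ℝ y e = 0 ∧
      |s| ≤ ‖z - p‖ ∧ ‖y‖ ≤ ‖z - p‖ := by
    intro z
    set s : ℝ := inner ℝ (z - p) e with hs
    have horth : inner ℝ (z - p - s • e) e = 0 := by
      rw [inner_sub_left, inner_smul_left, real_inner_self_eq_norm_sq, he]
      simp [hs]
    refine ⟨z - p - s • e, s, by abel, horth, ?_, ?_⟩
    · simpa [he] using abs_real_inner_le_norm (z - p) e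
    · have h1 : ‖z - p‖ ^ 2 = ‖z - p - s • e‖ ^ 2 + ‖s • e‖ ^ 2 := by
        have : z - p = (z - p - s • e) + s • e := by abel
        conv_lhs => rw [this]
        rw [norm_add_sq_real, inner_smul_right, horth]
        ring
      exact abs_le_of_sq_le_sq' (by nlinarith [sq_nonneg ‖s • e‖]) (norm_nonneg _) |>.2
  -- Since `p` is a limit of points below the graph, the graph passes at height at least `0` there.
  have hγ0 : 0 ≤ γ 0 := by
    by_contra! hneg
    obtain ⟨ε, hε, hεγ⟩ := Metric.continuousAt_iff.1 hγ.continuousAt (-γ 0 / 2) (by linarith)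
    set η := min (min ε R) (min h (-γ 0 / 2)) with hη
    have hηpos : 0 < η := by
      simp only [hη, lt_min_iff]; exact ⟨⟨hε, hR⟩, hh, by linarith⟩
    obtain ⟨z, hzG, hzp⟩ := Metric.mem_closure_iff.1 (frontier_subset_closure hp) η hηpos
    rw [dist_comm, dist_eq_norm] at hzp
    simp only [hη, lt_min_iff] at hzp
    obtain ⟨y, s, rfl, hy, hs1, hy1⟩ := hdec z
    have h1 := (hG y hy (hy1.trans_lt hzp.1.2) s (hs1.trans_lt hzp.2.1)).1 hzG
    have h2 := hεγ (x := y) (by rw [dist_zero_right]; exact hy1.trans_lt hzp.1.1)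
    rw [Real.dist_eq] at h2
    have h3 := (abs_lt.1 h2).2
    have h4 := (abs_le.1 (hs1.trans hzp.2.2.le)).1
    linarith
  have hq : p + (-(h / 2)) • e ∈ G.carrier := by
    have := (hG 0 (by simp) (by simpa using hR) (-(h / 2))
      (by rw [abs_neg, abs_of_pos (half_pos hh)]; linarith)).2 (by linarith)
    simpa using this
  obtain ⟨δ, hδ, hctrl⟩ := G.exists_isControlled_ball (κ := κ) hr hb hq
  refine ⟨min δ (min R (h / 2)), by simp only [gt_iff_lt, lt_min_iff]; exact ⟨hδ, hR, half_pos hh⟩,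
    hctrl.of_translate (v := (-(h / 2)) • e) G.isOpen G.volume_ne_top
      Metric.isOpen_ball.measurableSet ?_ ?_⟩
  · rintro z ⟨hz, -⟩
    have h1 := mem_ball_iff_norm.1 hz
    rw [mem_ball_iff_norm]
    calc ‖z + -(h / 2) • e - (p + -(h / 2) • e)‖ = ‖z - p‖ := by congr 1; abel
      _ < δ := h1.trans_le (min_le_left _ _)
  · rintro z ⟨hz, hzG⟩ t ht
    have h1 := mem_ball_iff_norm.1 hz
    simp only [lt_min_iff] at h1
    obtain ⟨y, s, rfl, hy, hs1, hy1⟩ := hdec z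
    have hs2 := hs1.trans_lt h1.2.2
    have hsγ := (hG y hy (hy1.trans_lt h1.2.1) s (by linarith)).1 hzG
    have hth : 0 ≤ t * (h / 2) := mul_nonneg ht.1 (half_pos hh).le
    have hth' : t * (h / 2) ≤ h / 2 := mul_le_of_le_one_left (half_pos hh).le ht.2
    have e1 : p + y + s • e + t • -(h / 2) • e = p + y + (s - t * (h / 2)) • e := by module
    rw [e1]
    refine (hG y hy (hy1.trans_lt h1.2.1) _ ?_).2 (by linarith)
    have := abs_lt.1 hs2
    rw [abs_lt]; constructor <;> linarith

/-- Compactness of the closure reduces the control of the whole domain to that of neighbourhoods of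
single points. -/
theorem BoundedDomain.isControlled (G : BoundedDomain d) {b : Vec d} {r : ℝ}
    (hr : 0 < r) (hb : b ∈ G.carrier) :
    IsControlled κ G.carrier (Metric.ball b r) G.carrier := by
  have hc : IsCompact (closure G.carrier) := G.isBounded.isCompact_closure
  have := hc.induction_on
    (p := fun s => IsControlled κ G.carrier (Metric.ball b r) (s ∩ G.carrier))
    ⟨0, by simp, by simp⟩ (fun s t hst ht => ht.mono (inter_subset_inter_left _ hst))
    (fun s t hs ht => by rw [union_inter_distrib_right]; exact hs.union ht) ?_
  · exact this.mono (subset_inter subset_closure subset_rfl)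
  intro x hx
  by_cases hxG : x ∈ G.carrier
  · obtain ⟨δ, hδ, h⟩ := G.exists_isControlled_ball (κ := κ) hr hb hxG
    exact ⟨_, mem_nhdsWithin_of_mem_nhds (Metric.ball_mem_nhds x hδ), h.mono inter_subset_left⟩
  · obtain ⟨δ, hδ, h⟩ := G.exists_isControlled_frontier (κ := κ) hr hb
      (p := x) (by rw [G.isOpen.frontier_eq]; exact ⟨hx, hxG⟩)
    exact ⟨_, mem_nhdsWithin_of_mem_nhds (Metric.ball_mem_nhds x hδ), h⟩

/-- The Poincaré inequality: an `H¹` function is close in `L²` to a constant. -/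
theorem BoundedDomain.exists_lintegral_sub_const_sq_le (G : BoundedDomain d) (κ : Type*)
    [Fintype κ] :
    ∃ C : ℝ≥0∞, C ≠ ∞ ∧ ∀ (f : Vec d → EuclideanSpace ℝ κ)
      (D : Vec d → EuclideanSpace ℝ (κ × Fin d)), IsH1 G.carrier f D →
        ∃ c, ∫⁻ x in G.carrier, ‖f x - c‖ₑ ^ 2 ≤ C * ∫⁻ x in G.carrier, ‖D x‖ₑ ^ 2 := by
  obtain ⟨b, hb⟩ := G.isConnected.nonempty
  obtain ⟨r, hr, hB⟩ := Metric.isOpen_iff.1 G.isOpen b hb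
  obtain ⟨C, hC, h⟩ := G.isControlled (κ := κ) hr hb
  set K := ENNReal.ofReal (2 * r) ^ 2 * volume (Metric.ball (0 : Vec d) (2 * r)) with hK
  have hKtop : K ≠ ∞ := ENNReal.mul_ne_top (by finiteness) measure_ball_lt_top.ne
  have hb0 : volume (Metric.ball b r) ≠ 0 := (Metric.measure_ball_pos volume b hr).ne'
  have hbt : volume (Metric.ball b r) ≠ ∞ := measure_ball_lt_top.ne
  refine ⟨C * ((volume (Metric.ball b r))⁻¹ * K + 1), ?_, fun f D hf => ?_⟩
  · exact ENNReal.mul_ne_top hC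
      (ENNReal.add_ne_top.2 ⟨ENNReal.mul_ne_top (ENNReal.inv_ne_top.2 hb0) hKtop, by simp⟩)
  have hfm := hf.measurable
  have hm : Measurable fun y => ∫⁻ x in Metric.ball b r, ‖f x - f y‖ₑ ^ 2 := by
    refine Measurable.lintegral_prod_left' (f := fun p : Vec d × Vec d => ‖f p.1 - f p.2‖ₑ ^ 2) ?_
    fun_prop
  -- Some value of `f` on the ball does at least as well as the average.
  obtain ⟨y, -, hy⟩ := exists_le_setLAverage hb0 hbt hm.aemeasurable
  refine ⟨f y, ?_⟩
  have h1 := h _ D (hf.sub_const G.volume_ne_top (f y))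
  rw [mul_assoc]
  refine h1.trans ?_
  rw [add_mul, one_mul]
  gcongr
  refine hy.trans ?_
  rw [setLAverage_eq, ENNReal.div_eq_inv_mul, mul_assoc]
  gcongr
  exact hf.lintegral_lintegral_ball_le G.isOpen G.volume_ne_top hB

theorem lintegral_enorm_sq_eq_ofReal {α X : Type*} [MeasurableSpace α] {μ : Measure α}
    [NormedAddCommGroup X] {f : α → X} (hf : MemLp f 2 μ) :
    ∫⁻ x, ‖f x‖ₑ ^ 2 ∂μ = ENNReal.ofReal (∫ x, ‖f x‖ ^ 2 ∂μ) := by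
  rw [ofReal_integral_eq_lintegral_ofReal (hf.integrable_norm_pow (by simp))
    (Eventually.of_forall fun x => by positivity)]
  refine lintegral_congr fun x => ?_
  rw [ENNReal.ofReal_pow (norm_nonneg _), ofReal_norm]

theorem eLpNorm_two_eq_ofReal_sqrt {α X : Type*} [MeasurableSpace α] {μ : Measure α}
    [NormedAddCommGroup X] {f : α → X} (hf : MemLp f 2 μ) :
    eLpNorm f 2 μ = ENNReal.ofReal (√(∫ x, ‖f x‖ ^ 2 ∂μ)) := by
  have := eLpNorm_nnreal_pow_eq_lintegral (f := f) (μ := μ) (p := 2) two_ne_zero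
  simp only [NNReal.coe_ofNat, ENNReal.rpow_ofNat, ENNReal.coe_ofNat] at this
  rw [lintegral_enorm_sq_eq_ofReal hf] at this
  have h0 : 0 ≤ ∫ x, ‖f x‖ ^ 2 ∂μ := integral_nonneg fun _ => by positivity
  rw [← Real.sq_sqrt h0, ENNReal.ofReal_pow (Real.sqrt_nonneg _)] at this
  exact (ENNReal.pow_right_strictMono two_ne_zero).injective this

theorem Lp.norm_sq_eq_integral {α X : Type*} [MeasurableSpace α] {μ : Measure α}
    [NormedAddCommGroup X] (f : Lp X 2 μ) : ‖f‖ ^ 2 = ∫ x, ‖f x‖ ^ 2 ∂μ := by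
  rw [Lp.norm_def, eLpNorm_two_eq_ofReal_sqrt (Lp.memLp f),
    ENNReal.toReal_ofReal (Real.sqrt_nonneg _),
    Real.sq_sqrt (integral_nonneg fun _ => by positivity)]

/-- The Poincaré inequality on `𝒱`. -/
theorem BoundedDomain.exists_norm_toL2_sq_le (G : BoundedDomain d) (k : ℕ) :
    ∃ C > 0, ∀ z : sobolevV G k, ‖toL2 z‖ ^ 2 ≤ C * ‖grad z‖ ^ 2 := by
  obtain ⟨C, hC, h⟩ := G.exists_lintegral_sub_const_sq_le (Fin k)
  refine ⟨C.toReal + 1, by positivity, fun z => ?_⟩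
  have hz : IsH1 G.carrier (toL2 z : Vec d → Vec k) (grad z) :=
    ⟨(Lp.stronglyMeasurable _).measurable, (Lp.stronglyMeasurable _).measurable,
      Lp.memLp _, Lp.memLp _, z.2.2⟩
  obtain ⟨c, hc⟩ := h _ _ hz
  have hmean : ∫ x, toL2 z x ∂G.vol = 0 := z.2.1
  have hu2 : MemLp (toL2 z) 2 G.vol := Lp.memLp _
  have hu : Integrable (toL2 z) G.vol := hu2.integrable one_le_two
  have hsub : MemLp (fun x => toL2 z x - c) 2 G.vol := hu2.sub (memLp_const c)
  -- Among the constants, the mean is the best approximation in `L²`.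
  have e1 : ∫ x, ‖toL2 z x‖ ^ 2 ∂G.vol ≤ ∫ x, ‖toL2 z x - c‖ ^ 2 ∂G.vol := by
    have e2 : ∀ x, ‖toL2 z x - c‖ ^ 2 =
        ‖toL2 z x‖ ^ 2 - 2 * inner ℝ (toL2 z x) c + ‖c‖ ^ 2 := fun x =>
      norm_sub_sq_real (toL2 z x) c
    have e3 : ∫ x, inner ℝ ((toL2 z : Vec d → Vec k) x) c ∂G.vol = 0 := by
      have := integral_inner (𝕜 := ℝ) hu c
      simp only [hmean, inner_zero_right] at this
      simpa only [real_inner_comm] using this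
    have i1 : Integrable (fun x => inner ℝ (toL2 z x) c) G.vol := hu.inner_const (𝕜 := ℝ) c
    have i0 : Integrable (fun x => ‖toL2 z x‖ ^ 2) G.vol := hu2.integrable_norm_pow (by simp)
    have i2 : Integrable (fun x => ‖toL2 z x‖ ^ 2 - 2 * inner ℝ (toL2 z x) c) G.vol :=
      i0.sub (i1.const_mul 2)
    simp only [e2]
    rw [integral_add i2 (integrable_const _),
      integral_sub i0 (i1.const_mul 2), integral_const_mul, e3]
    have : 0 ≤ ∫ _, ‖c‖ ^ 2 ∂G.vol := integral_nonneg fun _ => by positivity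
    linarith
  rw [Lp.norm_sq_eq_integral, Lp.norm_sq_eq_integral]
  have hI : 0 ≤ ∫ x, ‖grad z x‖ ^ 2 ∂G.vol := integral_nonneg fun _ => by positivity
  rw [lintegral_enorm_sq_eq_ofReal hsub, lintegral_enorm_sq_eq_ofReal (Lp.memLp (grad z)),
    ← ENNReal.ofReal_toReal hC,
    ← ENNReal.ofReal_mul ENNReal.toReal_nonneg,
    ENNReal.ofReal_le_ofReal_iff (mul_nonneg ENNReal.toReal_nonneg hI)] at hc
  linarith

end Domain

/-! ### Weak time derivatives and absolute continuity -/

section Time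

variable {X Y : Type*} [NormedAddCommGroup X] [NormedSpace ℝ X] [NormedAddCommGroup Y]
  [NormedSpace ℝ Y] {T : ℝ} {f g : ℝ → X}

/-- A function whose increments are dominated by those of an absolutely continuous function is
absolutely continuous. -/
theorem AbsolutelyContinuousOnInterval.of_dist_le {X Y : Type*} [PseudoMetricSpace X]
    [PseudoMetricSpace Y] {f : ℝ → X} {g : ℝ → Y} {a b K : ℝ}
    (hg : AbsolutelyContinuousOnInterval g a b)
    (h : ∀ s ∈ uIcc a b, ∀ t ∈ uIcc a b, dist (f s) (f t) ≤ K * dist (g s) (g t)) :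
    AbsolutelyContinuousOnInterval f a b := by
  have hK := (show Tendsto _ _ _ from hg).const_mul K
  rw [mul_zero] at hK
  refine squeeze_zero' (Eventually.of_forall fun E => Finset.sum_nonneg fun i _ => dist_nonneg)
    ?_ hK
  filter_upwards [mem_inf_of_right (mem_principal_self _)] with E hE
  rw [Finset.mul_sum]
  exact Finset.sum_le_sum fun i hi => h _ (hE.1 i hi).1 _ (hE.1 i hi).2

/-- `f` is absolutely continuous on `[0, T]` with almost everywhere derivative `g`. -/
structure IsACWithDeriv (T : ℝ) (f g : ℝ → X) : Prop where
  ac : AbsolutelyContinuousOnInterval f 0 T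
  hasDerivAt : ∀ᵐ t ∂volume.restrict (Ioo 0 T), HasDerivAt f (g t) t

omit [NormedSpace ℝ X] in
theorem MemL2Time.integrableOn (hf : MemL2Time T f) : IntegrableOn f (Ioo 0 T) :=
  MemLp.integrable one_le_two hf

theorem IsWeakTimeDeriv.isWeakDerivAlong (h : IsWeakTimeDeriv T f g) (v : ℝ) :
    IsWeakDerivAlong volume (Ioo 0 T) v f fun t => v • g t := by
  intro φ hφ
  have e1 : ∀ t, fderiv ℝ φ t v • f t = v • (deriv φ t • f t) := fun t => by
    rw [fderiv_eq_smul_deriv, smul_smul, smul_eq_mul]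
  have e2 : ∀ t, φ t • v • g t = v • φ t • g t := fun t => smul_comm _ _ _
  simp only [e1, e2]
  rw [integral_smul, integral_smul, h φ hφ, smul_neg]

/-- The continuous representative of an `H¹` function of time is the integral of its weak
derivative. -/
theorem IsH1Time.eq_add_integral [CompleteSpace X] (hT : 0 < T) (h : IsH1Time T f g)
    (hf : ContinuousOn f (Icc 0 T)) :
    ∀ t ∈ Icc 0 T, f t = f 0 + ∫ r in 0..t, g r := by
  have hfi := h.1.integrableOn
  have hgi := h.2.1.integrableOn
  have hgI : IntegrableOn g (Icc 0 T) := by rwa [integrableOn_Icc_iff_integrableOn_Ioo]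
  have hint : ∀ {a b : ℝ}, a ∈ Icc 0 T → b ∈ Icc 0 T → IntervalIntegrable g volume a b :=
    fun {a b} ha hb => by
      rw [intervalIntegrable_iff]
      exact hgI.mono_set ((uIoc_subset_uIcc).trans (uIcc_subset_Icc ha hb))
  -- The difference `k` is continuous and has the same value at any two interior times.
  set k : ℝ → X := fun t => f t - ∫ r in 0..t, g r with hk
  have hkc : ContinuousOn k (Icc 0 T) := by
    refine hf.sub ?_
    have := intervalIntegral.continuousOn_primitive_interval (f := g) (a := 0) (b := T)
      (by rwa [uIcc_of_le hT.le])
    rwa [uIcc_of_le hT.le] at this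
  have step : ∀ s ∈ Ioo 0 T, ∀ t ∈ Ioo 0 T, s < t → k t = k s := by
    intro s hs t ht hst
    set v := t - s with hv
    have hv0 : 0 < v := sub_pos.2 hst
    have hae := (h.2.2.isWeakDerivAlong v).ae_sub_eq_integral isOpen_Ioo hfi (hgi.smul v)
    have hU : EqOn (fun x => k (x + v)) k (Ioo 0 (T - v)) := by
      refine Measure.eqOn_open_of_ae_eq (μ := volume) ?_ isOpen_Ioo ?_ ?_
      · rw [EventuallyEq, ae_restrict_iff' measurableSet_Ioo]
        filter_upwards [hae] with x hx hxU
        have hseg : ∀ r ∈ Icc (0 : ℝ) 1, x + r • v ∈ Ioo 0 T := by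
          intro r hr
          have h1 : 0 ≤ r * v := mul_nonneg hr.1 hv0.le
          have h2 : r * v ≤ v := mul_le_of_le_one_left hv0.le hr.2
          simp only [smul_eq_mul, mem_Ioo] at hxU ⊢
          constructor <;> linarith [hxU.1, hxU.2]
        have h3 := hx hseg
        simp only [Pi.smul_apply] at h3
        rw [← intervalIntegral.integral_of_le zero_le_one, intervalIntegral.integral_smul] at h3
        have h4 := intervalIntegral.smul_integral_comp_add_mul (a := 0) (b := 1) g v x
        simp only [mul_zero, mul_one, add_zero] at h4
        simp only [smul_eq_mul, mul_comm _ v] at h3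
        rw [h4] at h3
        have m0 : (0 : ℝ) ∈ Icc 0 T := ⟨le_rfl, hT.le⟩
        have mx : x ∈ Icc 0 T := ⟨hxU.1.le, by linarith [hxU.2]⟩
        have mxv : x + v ∈ Icc 0 T := ⟨by linarith [hxU.1], by linarith [hxU.2]⟩
        have h5 := intervalIntegral.integral_add_adjacent_intervals (hint m0 mx) (hint mx mxv)
        simp only [hk]
        rw [← h5, ← h3]
        abel
      · refine hkc.comp (by fun_prop) fun x hx => ?_
        simp only [mem_Ioo, mem_Icc] at hx ⊢
        constructor <;> linarith [hx.1, hx.2]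
      · exact hkc.mono fun x hx => ⟨hx.1.le, by linarith [hx.2]⟩
    have := hU (x := s) ⟨hs.1, by linarith [ht.2]⟩
    simpa [hv] using this
  have hm : T / 2 ∈ Ioo 0 T := ⟨by linarith, by linarith⟩
  have hconst : EqOn k (fun _ => k (T / 2)) (Icc 0 T) := by
    have : EqOn k (fun _ => k (T / 2)) (Ioo 0 T) := by
      intro t ht
      rcases lt_trichotomy t (T / 2) with h1 | h1 | h1
      · exact (step t ht _ hm h1).symm
      · rw [h1]
      · exact step _ hm t ht h1
    refine this.of_subset_closure hkc continuousOn_const Ioo_subset_Icc_self ?_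
    rw [closure_Ioo hT.ne]
  intro t ht
  have h0 := hconst ⟨le_rfl, hT.le⟩
  have h1 := hconst ht
  simp only [hk, intervalIntegral.integral_same, sub_zero] at h0 h1
  rw [h0, ← h1]
  abel

theorem IsH1Time.isACWithDeriv [CompleteSpace X] (hT : 0 < T) (h : IsH1Time T f g)
    (hf : ContinuousOn f (Icc 0 T)) : IsACWithDeriv T f g := by
  have hrep := h.eq_add_integral hT hf
  have hgI : IntegrableOn g (Icc 0 T) := by
    rw [integrableOn_Icc_iff_integrableOn_Ioo]; exact h.2.1.integrableOn
  have hgT : IntervalIntegrable g volume 0 T := by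
    rwa [intervalIntegrable_iff_integrableOn_Icc_of_le hT.le]
  have hint : ∀ {a b : ℝ}, a ∈ Icc 0 T → b ∈ Icc 0 T → IntervalIntegrable g volume a b :=
    fun {a b} ha hb => by
      rw [intervalIntegrable_iff]
      exact hgI.mono_set ((uIoc_subset_uIcc).trans (uIcc_subset_Icc ha hb))
  have m0 : (0 : ℝ) ∈ Icc 0 T := ⟨le_rfl, hT.le⟩
  refine ⟨?_, ?_⟩
  · refine AbsolutelyContinuousOnInterval.of_dist_le (K := 1)
      (hgT.norm.absolutelyContinuousOnInterval_intervalIntegral (c := 0) left_mem_uIcc) ?_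
    rw [uIcc_of_le hT.le]
    intro s hs t ht
    rw [one_mul, hrep s hs, hrep t ht, dist_add_left, dist_eq_norm, dist_eq_norm,
      intervalIntegral.integral_interval_sub_left (hint m0 hs) (hint m0 ht),
      intervalIntegral.integral_interval_sub_left (hint m0 hs).norm (hint m0 ht).norm]
    exact intervalIntegral.norm_integral_le_abs_integral_norm
  · rw [ae_restrict_iff' measurableSet_Ioo]
    filter_upwards [hgT.ae_hasDerivAt_integral] with t ht htT
    have h1 := ht (by rw [uIcc_of_le hT.le]; exact ⟨htT.1.le, htT.2.le⟩) 0 left_mem_uIcc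
    refine (h1.const_add (f 0)).congr_of_eventuallyEq ?_
    filter_upwards [Ioo_mem_nhds htT.1 htT.2] with s hs
    exact hrep s ⟨hs.1.le, hs.2.le⟩

theorem IsACWithDeriv.clm (h : IsACWithDeriv T f g) (L : X →L[ℝ] Y) :
    IsACWithDeriv T (fun t => L (f t)) fun t => L (g t) := by
  refine ⟨AbsolutelyContinuousOnInterval.of_dist_le h.ac (K := ‖L‖) fun s _ t _ => ?_, ?_⟩
  · exact L.lipschitz.dist_le_mul _ _
  · filter_upwards [h.hasDerivAt] with t ht using L.hasFDerivAt.comp_hasDerivAt t ht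

theorem IsACWithDeriv.add {f' g' : ℝ → X} (h : IsACWithDeriv T f g) (h' : IsACWithDeriv T f' g') :
    IsACWithDeriv T (fun t => f t + f' t) fun t => g t + g' t :=
  ⟨h.ac.add h'.ac, by
    filter_upwards [h.hasDerivAt, h'.hasDerivAt] with t h1 h2 using h1.add h2⟩

theorem IsACWithDeriv.sub_const (h : IsACWithDeriv T f g) (c : X) :
    IsACWithDeriv T (fun t => f t - c) g := by
  refine ⟨AbsolutelyContinuousOnInterval.of_dist_le h.ac (K := 1) fun s _ t _ => ?_, ?_⟩
  · simp
  · filter_upwards [h.hasDerivAt] with t ht using ht.sub_const c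

theorem IsACWithDeriv.const_mul {f g : ℝ → ℝ} (h : IsACWithDeriv T f g) (c : ℝ) :
    IsACWithDeriv T (fun t => c * f t) fun t => c * g t :=
  ⟨h.ac.const_mul c, by filter_upwards [h.hasDerivAt] with t ht using ht.const_mul c⟩

theorem IsACWithDeriv.norm_sq {X : Type*} [NormedAddCommGroup X] [InnerProductSpace ℝ X]
    {f g : ℝ → X} (h : IsACWithDeriv T f g) :
    IsACWithDeriv T (fun t => ‖f t‖ ^ 2) fun t => 2 * inner ℝ (f t) (g t) := by
  obtain ⟨M, hM⟩ := isCompact_uIcc.exists_bound_of_continuousOn h.ac.continuousOn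
  refine ⟨AbsolutelyContinuousOnInterval.of_dist_le h.ac (K := 2 * M) fun s hs t ht => ?_, ?_⟩
  · rw [Real.dist_eq, dist_eq_norm]
    have h1 : ‖f s‖ ^ 2 - ‖f t‖ ^ 2 = (‖f s‖ + ‖f t‖) * (‖f s‖ - ‖f t‖) := by ring
    rw [h1, abs_mul, abs_of_nonneg (by positivity)]
    have := hM s hs
    have := hM t ht
    exact mul_le_mul (by linarith) (abs_norm_sub_norm_le _ _) (abs_nonneg _)
      (by linarith [norm_nonneg (f s)])
  · filter_upwards [h.hasDerivAt] with t ht using ht.norm_sq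

/-- Grönwall's inequality for absolutely continuous functions. -/
theorem IsACWithDeriv.le_exp_mul {y y' : ℝ → ℝ} (h : IsACWithDeriv T y y') (hT : 0 ≤ T) {b : ℝ}
    (hy : ∀ᵐ t ∂volume.restrict (Ioo 0 T), y' t ≤ -b * y t) :
    y T ≤ Real.exp (-b * T) * y 0 := by
  have hexp : AbsolutelyContinuousOnInterval (fun t : ℝ => Real.exp (b * t)) 0 T :=
    ContDiffOn.absolutelyContinuousOnInterval (by fun_prop)
  have hac := hexp.mul h.ac
  have hneg : ∫ t in 0..T, deriv ((fun t : ℝ => Real.exp (b * t)) * y) t ≤ 0 := by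
    rw [intervalIntegral.integral_of_le hT, integral_Ioc_eq_integral_Ioo]
    refine integral_nonpos_of_ae ?_
    filter_upwards [h.hasDerivAt, hy] with t h1 h2
    have h3 : HasDerivAt (fun t : ℝ => Real.exp (b * t)) (Real.exp (b * t) * b) t := by
      simpa using ((hasDerivAt_id t).const_mul b).exp
    rw [(h3.mul h1).deriv]
    have := Real.exp_pos (b * t)
    simp only [Pi.zero_apply]
    nlinarith
  rw [hac.integral_deriv_eq_sub] at hneg
  simp only [Pi.mul_apply, mul_zero, Real.exp_zero, one_mul] at hneg
  have h1 : Real.exp (-b * T) * Real.exp (b * T) = 1 := by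
    rw [← Real.exp_add]; simp
  have h2 := Real.exp_pos (-b * T)
  calc y T = Real.exp (-b * T) * (Real.exp (b * T) * y T) := by rw [← mul_assoc, h1, one_mul]
    _ ≤ _ := by gcongr; linarith

/-- Weak time derivatives are unique. -/
theorem IsWeakTimeDeriv.ae_eq [CompleteSpace X] {g' : ℝ → X} (h : IsWeakTimeDeriv T f g)
    (h' : IsWeakTimeDeriv T f g') (hg : MemL2Time T g) (hg' : MemL2Time T g') :
    ∀ᵐ t ∂volume.restrict (Ioo 0 T), g t = g' t := by
  have hi : IntegrableOn (fun t => g t - g' t) (Ioo 0 T) := hg.integrableOn.sub hg'.integrableOn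
  have key : ∀ᵐ t, t ∈ Ioo 0 T → g t - g' t = 0 := by
    refine isOpen_Ioo.ae_eq_zero_of_integral_contDiff_smul_eq_zero hi.locallyIntegrableOn ?_
    intro φ h1 h2 h3
    have hφ : IsTest (Ioo 0 T) φ := ⟨h1, h2, h3⟩
    have e := neg_injective ((h φ hφ).symm.trans (h' φ hφ))
    rw [← setIntegral_eq_integral_of_forall_compl_eq_zero (s := Ioo 0 T)]
    · simp only [smul_sub]
      rw [integral_sub (hφ.integrable_smul hg.integrableOn)
        (hφ.integrable_smul hg'.integrableOn), e, sub_self]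
    · intro x hx
      rw [image_eq_zero_of_notMem_tsupport fun hx' => hx (h3 hx'), zero_smul]
  rw [ae_restrict_iff' measurableSet_Ioo]
  filter_upwards [key] with t ht htT using sub_eq_zero.1 (ht htT)

theorem MemL2Time.clm (hf : MemL2Time T f) (L : X →L[ℝ] Y) : MemL2Time T fun t => L (f t) :=
  L.comp_memLp' hf

theorem IsWeakTimeDeriv.clm [CompleteSpace X] [CompleteSpace Y] (h : IsWeakTimeDeriv T f g)
    (hf : MemL2Time T f) (hg : MemL2Time T g) (L : X →L[ℝ] Y) :
    IsWeakTimeDeriv T (fun t => L (f t)) fun t => L (g t) := by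
  intro φ hφ
  have i1 : Integrable (fun t => deriv φ t • f t) (volume.restrict (Ioo 0 T)) := by
    simpa using hφ.integrable_fderiv_smul 1 hf.integrableOn
  have := congrArg L (h φ hφ)
  rw [map_neg, ← L.integral_comp_comm i1,
    ← L.integral_comp_comm (hφ.integrable_smul hg.integrableOn)] at this
  simpa only [map_smul] using this

end Time

variable {d k : ℕ} {G : BoundedDomain d}

/-! ### Coercivity of the diffusion tensor -/

/-- The embedding of `L^∞` into `L²` over a space of finite measure. -/
def linfToL2 (α X : Type*) [MeasurableSpace α] [NormedAddCommGroup X] [NormedSpace ℝ X]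
    (μ : Measure α) [IsFiniteMeasure μ] : Lp X ∞ μ →L[ℝ] Lp X 2 μ :=
  LinearMap.mkContinuous
    { toFun := fun f => ((Lp.memLp f).mono_exponent le_top).toLp f
      map_add' := fun f g => by
        rw [← MemLp.toLp_add, MemLp.toLp_eq_toLp_iff]
        exact Lp.coeFn_add f g
      map_smul' := fun r f => by
        rw [RingHom.id_apply, ← MemLp.toLp_const_smul, MemLp.toLp_eq_toLp_iff]
        exact Lp.coeFn_smul r f }
    ((μ univ ^ (1 / (2 : ℝ≥0∞).toReal - 1 / (∞ : ℝ≥0∞).toReal)).toReal) fun f => by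
      have h := eLpNorm_le_eLpNorm_mul_rpow_measure_univ (p := 2) (q := ∞) le_top
        (Lp.aestronglyMeasurable f)
      have h2 : μ univ ^ (1 / (2 : ℝ≥0∞).toReal - 1 / (∞ : ℝ≥0∞).toReal) ≠ ∞ :=
        ENNReal.rpow_ne_top_of_nonneg (by simp) (measure_ne_top _ _)
      have h3 := ENNReal.toReal_mono (ENNReal.mul_ne_top (Lp.eLpNorm_ne_top f) h2) h
      rw [ENNReal.toReal_mul, mul_comm] at h3
      refine le_trans (le_of_eq (Lp.norm_toLp f ((Lp.memLp f).mono_exponent le_top))) ?_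
      simpa [Lp.norm_def] using h3

theorem coeFn_linfToL2 {α X : Type*} [MeasurableSpace α] [NormedAddCommGroup X] [NormedSpace ℝ X]
    {μ : Measure α} [IsFiniteMeasure μ] (f : Lp X ∞ μ) : linfToL2 α X μ f =ᵐ[μ] f :=
  MemLp.coeFn_toLp ((Lp.memLp f).mono_exponent le_top)

/-- The tensor `D ⊗ D`. -/
def tensorSq (D : Mat k d) : Tensor k d := WithLp.toLp 2 fun p => D p.1 * D p.2

theorem inner_tensorSq (D : Mat k d) (K : Tensor k d) :
    inner ℝ (tensorSq D) K = inner ℝ (K.app D) D := by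
  simp only [PiLp.inner_apply, tensorSq, Tensor.app, Fintype.sum_prod_type (α₁ := Fin k × Fin d),
    RCLike.inner_apply, conj_trivial, Finset.mul_sum]
  refine Finset.sum_congr rfl fun p _ => Finset.sum_congr rfl fun q _ => by ring

theorem continuous_inner_app (K : Tensor k d) : Continuous fun D : Mat k d =>
    inner ℝ (K.app D) D := by
  simp only [PiLp.inner_apply, Tensor.app]
  fun_prop

/-- If the response and the initial tensor are coercive, then so is the tensor at all later times:
for every set `A` and every matrix `D`, the function `y(t) = ∫_A ((H(t) D) : D - κ D : D)` satisfies
`τ y' + y ≥ 0` and `y(0) ≥ 0`, hence `y(t) ≥ 0`. -/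
theorem IsGlobalStrongSolution.coercive {τ κ : ℝ} (hτ : 0 < τ) {F : Mat k d → Tensor k d}
    (hF : ∀ D, F D ∈ symGE k d κ) {u₀ : L2Vec G k} {H₀ : LinfTensor G k}
    (hH₀ : ∀ᵐ x ∂G.vol, H₀ x ∈ symGE k d κ) {u : ℝ → L2Vec G k} {H : ℝ → LinfTensor G k}
    (h : IsGlobalStrongSolution G k τ F u₀ H₀ u H) {T : ℝ} (hT : 0 < T) :
    ∀ᵐ x ∂G.vol, ∀ D : Mat k d, κ * inner ℝ D D ≤ inner ℝ ((H T x).app D) D := by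
  obtain ⟨⟨-, hHc, -, hH0, -, v, w, H', -, -, -, hHt, -, heq⟩, -⟩ := h T hT
  have hac := hHt.isACWithDeriv hT hHc
  have hint : ∀ K : LinfTensor G k, Integrable K G.vol := fun K =>
    ((Lp.memLp K).mono_exponent (p := 2) le_top).integrable one_le_two
  have hpair : ∀ (A : Set (Vec d)) (hA : MeasurableSet A) (D : Mat k d) (K : LinfTensor G k),
      innerSL ℝ (indicatorConstLp 2 hA (measure_ne_top G.vol A) (tensorSq D))
        (linfToL2 _ _ G.vol K) = ∫ x in A, inner ℝ ((K x).app D) D ∂G.vol := by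
    intro A hA D K
    rw [innerSL_apply_apply, L2.inner_indicatorConstLp_eq_setIntegral_inner]
    refine integral_congr_ae (ae_restrict_of_ae ?_)
    filter_upwards [coeFn_linfToL2 K] with x hx
    rw [hx, inner_tensorSq]
  have hDint : ∀ (D : Mat k d) (K : LinfTensor G k),
      Integrable (fun x => inner ℝ ((K x).app D) D) G.vol := by
    intro D K
    simp only [← inner_tensorSq]
    exact (hint K).const_inner (𝕜 := ℝ) _
  have key : ∀ (A : Set (Vec d)), MeasurableSet A → ∀ D : Mat k d,
      ∫ _ in A, κ * inner ℝ D D ∂G.vol ≤ ∫ x in A, inner ℝ ((H T x).app D) D ∂G.vol := by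
    intro A hA D
    set L : LinfTensor G k →L[ℝ] ℝ :=
      innerSL ℝ (indicatorConstLp 2 hA (measure_ne_top G.vol A) (tensorSq D)) ∘L
        linfToL2 _ _ G.vol with hL
    have hLK : ∀ K, L K = ∫ x in A, inner ℝ ((K x).app D) D ∂G.vol := hpair A hA D
    set m : ℝ := ∫ _ in A, κ * inner ℝ D D ∂G.vol
    have hy := ((hac.clm L).sub_const m).const_mul (-1)
    have hy' := hy.le_exp_mul hT.le (b := τ⁻¹) ?_
    · have h0 : m ≤ L (H 0) := by
        rw [hLK, hH0]
        refine integral_mono_ae (integrable_const _) (hDint D H₀).restrict (ae_restrict_of_ae ?_)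
        filter_upwards [hH₀] with x hx using hx.2 D
      have h1 : Real.exp (-τ⁻¹ * T) * (-1 * (L (H 0) - m)) ≤ 0 :=
        mul_nonpos_of_nonneg_of_nonpos (Real.exp_pos _).le (by linarith)
      rw [← hLK]
      linarith
    · filter_upwards [heq] with t ht
      have h1 : m ≤ τ * L (H' t) + L (H t) := by
        rw [hLK, hLK, ← integral_const_mul, ← integral_add ((hDint D _).restrict.const_mul τ)
          (hDint D _).restrict]
        refine integral_mono_ae (integrable_const _)
          (((hDint D _).restrict.const_mul τ).add (hDint D _).restrict) (ae_restrict_of_ae ?_)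
        filter_upwards [ht] with x hx
        have h2 := (hF (grad (v t) x)).2 D
        rw [← sub_eq_zero.1 hx, ← inner_tensorSq, inner_add_right, inner_smul_right,
          inner_tensorSq, inner_tensorSq] at h2
        exact h2
      have h3 : τ⁻¹ * (L (H t) - m) ≥ τ⁻¹ * (-(τ * L (H' t))) := by
        gcongr; linarith
      have h4 : τ⁻¹ * (-(τ * L (H' t))) = -L (H' t) := by field_simp
      linarith
  -- The exceptional null set depends on `D`; a countable dense set of matrices is enough.
  have hae : ∀ n : ℕ, ∀ᵐ x ∂G.vol, κ * inner ℝ (TopologicalSpace.denseSeq (Mat k d) n)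
      (TopologicalSpace.denseSeq (Mat k d) n) ≤
        inner ℝ ((H T x).app (TopologicalSpace.denseSeq (Mat k d) n))
          (TopologicalSpace.denseSeq (Mat k d) n) := fun n =>
    ae_le_of_forall_setIntegral_le (integrable_const _) (hDint _ _) fun A hA _ => key A hA _
  filter_upwards [ae_all_iff.2 hae] with x hx D
  refine (TopologicalSpace.denseRange_denseSeq (Mat k d)).induction_on D ?_ hx
  exact isClosed_le (by fun_prop) (continuous_inner_app _)

/-! ### The energy estimate -/

/-- The embedding `L² → 𝒱'` as a continuous linear map. -/
def toDualL (G : BoundedDomain d) (k : ℕ) : L2Vec G k →L[ℝ] StrongDual ℝ (sobolevV G k) :=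
  ContinuousLinearMap.precomp ℝ
    ((ContinuousLinearMap.fst ℝ (L2Vec G k) (L2Mat G k)) ∘L
      (WithLp.prodContinuousLinearEquiv 2 ℝ (L2Vec G k) (L2Mat G k)).toContinuousLinearMap ∘L
        (sobolevV G k).subtypeL) ∘L (innerSL ℝ)

theorem le_form {κ : ℝ} {K : LinfTensor G k}
    (hK : ∀ᵐ x ∂G.vol, ∀ D : Mat k d, κ * inner ℝ D D ≤ inner ℝ ((K x).app D) D)
    (z : sobolevV G k) : κ * ‖grad z‖ ^ 2 ≤ form K z z := by
  rw [Lp.norm_sq_eq_integral, ← integral_const_mul]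
  have happ : ∀ x, (K x).app (grad z x) = matMul (K x) (grad z x) := fun x => by
    simp only [Tensor.app, matMul, mul_comm]
  have hm : Measurable fun x => inner ℝ ((K x).app (grad z x)) (grad z x) := by
    have h1 := (Lp.stronglyMeasurable K).measurable
    have h2 := (Lp.stronglyMeasurable (grad z)).measurable
    simp only [PiLp.inner_apply, Tensor.app]
    fun_prop
  have hb : ∀ᵐ x ∂G.vol, ‖K x‖ ≤ ‖K‖ := by
    filter_upwards [ae_le_eLpNormEssSup (f := K) (μ := G.vol)] with x hx
    rw [Lp.norm_def, eLpNorm_exponent_top, ← toReal_enorm]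
    exact ENNReal.toReal_mono (by simpa using Lp.eLpNorm_ne_top K) hx
  have hz : Integrable (fun x => ‖grad z x‖ ^ 2) G.vol :=
    (Lp.memLp (grad z)).integrable_norm_pow (by simp)
  refine integral_mono_ae (hz.const_mul κ) ((hz.const_mul ‖K‖).mono' hm.aestronglyMeasurable ?_) ?_
  · filter_upwards [hb] with x hx
    calc ‖inner ℝ ((K x).app (grad z x)) (grad z x)‖
        ≤ ‖(K x).app (grad z x)‖ * ‖grad z x‖ := norm_inner_le_norm _ _
      _ ≤ ‖grad z x‖ * ‖K x‖ * ‖grad z x‖ := by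
        rw [happ]; gcongr; exact norm_matMul_le _ _
      _ = ‖K x‖ * ‖grad z x‖ ^ 2 := by ring
      _ ≤ _ := by gcongr
  · filter_upwards [hK] with x hx
    simpa only [real_inner_self_eq_norm_sq] using hx (grad z x)

/-- The deviation `H - F(0)` of the tensor from its equilibrium, as an element of `L²`. -/
def deviation (F : Mat k d → Tensor k d) (H : LinfTensor G k) : Lp (Tensor k d) 2 G.vol :=
  linfToL2 _ _ G.vol H - (memLp_const (F 0)).toLp _

theorem coeFn_deviation (F : Mat k d → Tensor k d) (H : LinfTensor G k) :
    deviation F H =ᵐ[G.vol] fun x => H x - F 0 := by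
  filter_upwards [Lp.coeFn_sub (linfToL2 _ _ G.vol H) ((memLp_const (F 0)).toLp _),
    coeFn_linfToL2 H, MemLp.coeFn_toLp (memLp_const (μ := G.vol) (p := 2) (F 0))] with x h1 h2 h3
  rw [deviation, h1, Pi.sub_apply, h2, h3]

theorem energy_eq (τ : ℝ) (F : Mat k d → Tensor k d) (u : L2Vec G k) (H : LinfTensor G k) :
    energy τ F u H = 1 / 2 * ‖u‖ ^ 2 + τ / 2 * ‖deviation F H‖ ^ 2 := by
  rw [energy, Lp.norm_sq_eq_integral, Lp.norm_sq_eq_integral]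
  congr 2
  refine integral_congr_ae ?_
  filter_upwards [coeFn_deviation F H] with x hx
  rw [hx]

/-- Exponential decay of the weighted energy `lam ‖u‖² + τ ‖H - F(0)‖²`: when the weight `lam` is
large, the dissipation `κ ‖∇u‖²` of `u` absorbs the forcing of `H` by `F(∇u) - F(0)`. -/
theorem IsGlobalStrongSolution.weighted_energy_le {τ κ c C lam b : ℝ} (hτ : 0 < τ)
    (hlam : 0 ≤ lam) (hc : c ^ 2 ≤ lam * κ) (hb : 0 ≤ b) (hbC : 2 * b * C ≤ κ)
    (hbτ : 2 * b * τ ≤ 1)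
    (hC : ∀ z : sobolevV G k, ‖toL2 z‖ ^ 2 ≤ C * ‖grad z‖ ^ 2) {F : Mat k d → Tensor k d}
    (hF : ∀ D, F D ∈ symGE k d κ) (hLip : ∀ D, ‖F D - F 0‖ ≤ c * ‖D‖) {u₀ : L2Vec G k}
    {H₀ : LinfTensor G k} (hH₀ : ∀ᵐ x ∂G.vol, H₀ x ∈ symGE k d κ) {u : ℝ → L2Vec G k}
    {H : ℝ → LinfTensor G k} (h : IsGlobalStrongSolution G k τ F u₀ H₀ u H) {T : ℝ}
    (hT : 0 < T) :
    lam * ‖u T‖ ^ 2 + τ * ‖deviation F (H T)‖ ^ 2 ≤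
      Real.exp (-(2 * b) * T) * (lam * ‖u 0‖ ^ 2 + τ * ‖deviation F (H 0)‖ ^ 2) := by
  obtain ⟨⟨huc, hHc, -, -, -, v, w, H', -, huv, hw, hHt, heq, hFeq⟩, ⟨u', hu', -⟩, -⟩ := h T hT
  have hu := hu'.isACWithDeriv hT huc
  have hH := ((hHt.isACWithDeriv hT hHc).clm (linfToL2 _ _ G.vol)).sub_const
    ((memLp_const (F 0)).toLp _)
  have hΦ := (hu.norm_sq.const_mul lam).add (hH.norm_sq.const_mul τ)
  refine hΦ.le_exp_mul hT.le ?_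
  have hd1 : MemL2Time T fun t => toDual (u' t) :=
    hu'.2.1.clm (Y := StrongDual ℝ (sobolevV G k)) (toDualL G k)
  have hd2 : IsWeakTimeDeriv T (fun t => toDual (u t)) fun t => toDual (u' t) :=
    hu'.2.2.clm (Y := StrongDual ℝ (sobolevV G k)) hu'.1 hu'.2.1 (toDualL G k)
  -- The weak time derivative in `𝒱'` is the one in `L²`, so that it may be tested with `u` itself.
  have hdual := hw.2.2.ae_eq hd2 hw.2.1 hd1
  filter_upwards [huv, hdual, heq, hFeq, ae_restrict_mem measurableSet_Ioo]
    with t huv hdual heq hFeq htT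
  have hcoer := h.coercive hτ hF hH₀ htT.1
  set η := deviation F (H t) with hη
  set m := ‖grad (v t)‖ with hm
  have h1 : inner ℝ (u t) (u' t) ≤ -(κ * m ^ 2) := by
    have e := heq (v t)
    rw [hdual, toDual_apply, ← huv, real_inner_comm] at e
    linarith [le_form hcoer (v t)]
  have h2 : ‖u t‖ ^ 2 ≤ C * m ^ 2 := by rw [huv]; exact hC _
  -- The forcing `F(∇u) - F(0) = τ ∂ₜH + (H - F(0))`.
  set R := τ • linfToL2 _ _ G.vol (H' t) + η with hR
  have h3 : ‖R‖ ≤ c * m := by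
    refine Lp.norm_le_mul_norm_of_ae_le_mul ?_
    filter_upwards [hFeq, Lp.coeFn_add (τ • linfToL2 _ _ G.vol (H' t)) η,
      Lp.coeFn_smul τ (linfToL2 _ _ G.vol (H' t)), coeFn_linfToL2 (H' t),
      coeFn_deviation F (H t)] with x e1 e2 e3 e4 e5
    rw [hR, e2, Pi.add_apply, e3, Pi.smul_apply, e4, hη, e5]
    have : τ • H' t x + (H t x - F 0) = F (grad (v t) x) - F 0 := by
      rw [← sub_eq_zero.1 e1]; abel
    rw [this]
    exact hLip _
  have h4 : τ * inner ℝ η (linfToL2 _ _ G.vol (H' t)) = inner ℝ η R - ‖η‖ ^ 2 := by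
    rw [hR, inner_add_right, inner_smul_right, real_inner_self_eq_norm_sq]; ring
  have h5 : inner ℝ η R ≤ ‖η‖ * (c * m) :=
    (real_inner_le_norm _ _).trans (mul_le_mul_of_nonneg_left h3 (norm_nonneg _))
  have h6 : 2 * (‖η‖ * (c * m)) ≤ ‖η‖ ^ 2 + c ^ 2 * m ^ 2 := by
    nlinarith [sq_nonneg (‖η‖ - c * m)]
  have h7 : c ^ 2 * m ^ 2 ≤ lam * κ * m ^ 2 := by gcongr
  have h8 : 2 * b * lam * ‖u t‖ ^ 2 ≤ lam * κ * m ^ 2 := by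
    calc 2 * b * lam * ‖u t‖ ^ 2 ≤ 2 * b * lam * (C * m ^ 2) := by gcongr
      _ = lam * m ^ 2 * (2 * b * C) := by ring
      _ ≤ lam * m ^ 2 * κ := by gcongr
      _ = _ := by ring
  have h9 : 2 * b * τ * ‖η‖ ^ 2 ≤ ‖η‖ ^ 2 := mul_le_of_le_one_left (sq_nonneg _) hbτ
  have h10 := mul_le_mul_of_nonneg_left h1 hlam
  change lam * (2 * inner ℝ (u t) (u' t)) + τ * (2 * inner ℝ η (linfToL2 _ _ G.vol (H' t))) ≤
    -(2 * b) * (lam * ‖u t‖ ^ 2 + τ * ‖η‖ ^ 2)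
  linarith

end ColorDiffusion
end

open ColorDiffusion
theorem mainTheorem4 (d k : ℕ) (G : BoundedDomain d) (τ c ω α : ℝ)
    (hτ : 0 < τ) (hc : 0 < c) (hω : 0 < ω) (hα : 0 < α) :
    ∃ C > 0, ∃ β > 0, ∀ F : Mat k d → Tensor k d,
      IsResponse c F → (∀ D, F D ∈ symGE k d ω) →
      ∀ (u₀ : sobolevV G k) (H₀ : LinfTensor G k), (∀ᵐ x ∂G.vol, H₀ x ∈ symGE k d α) →
      ∀ (u : ℝ → L2Vec G k) (H : ℝ → LinfTensor G k),
        IsGlobalStrongSolution G k τ F (toL2 u₀) H₀ u H →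
        (∀ t : ℝ, 0 ≤ t →
          energy τ F (u t) (H t) ≤ C * Real.exp (-2 * β * t) * energy τ F (u 0) (H 0)) ∧
        Tendsto u atTop (𝓝 0) ∧
        Tendsto (fun t => eLpNorm (fun x => H t x - F 0) 2 G.vol) atTop (𝓝 0) := by
  obtain ⟨P, hP, hPoinc⟩ := G.exists_norm_toL2_sq_le k
  set κ := min α ω with hκdef
  have hκ : 0 < κ := lt_min hα hω
  have hmono : ∀ {κ' : ℝ}, κ ≤ κ' → symGE k d κ' ⊆ symGE k d κ := fun {κ'} hle K hK =>
    ⟨hK.1, fun D => (mul_le_mul_of_nonneg_right hle real_inner_self_nonneg).trans (hK.2 D)⟩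
  -- The summand `1` makes the weighted energy dominate the energy.
  set lam := c ^ 2 / κ + 1 with hlam
  have hlam1 : 1 ≤ lam := by have : 0 ≤ c ^ 2 / κ := by positivity
                             linarith
  have hcl : c ^ 2 ≤ lam * κ := by
    rw [hlam, add_mul, div_mul_cancel₀ _ hκ.ne']; linarith
  -- Half of the dissipation of `u` and half of the relaxation of `H` remain for the decay.
  set β := min (κ / (2 * P)) (1 / (2 * τ)) with hβdef
  have hβ : 0 < β := lt_min (by positivity) (by positivity)
  have hβP : 2 * β * P ≤ κ := by
    have h1 : β ≤ κ / (2 * P) := min_le_left _ _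
    rw [le_div_iff₀ (by positivity)] at h1
    linarith
  have hβτ : 2 * β * τ ≤ 1 := by
    have h1 : β ≤ 1 / (2 * τ) := min_le_right _ _
    rw [le_div_iff₀ (by positivity)] at h1
    linarith
  refine ⟨lam, by linarith, β, hβ, fun F hF hFω u₀ H₀ hH₀ u H hsol => ?_⟩
  obtain ⟨hFc, -, -, J, hJm, hJb, hJ⟩ := hF
  have hLip : ∀ D, ‖F D - F 0‖ ≤ c * ‖D‖ := fun D => by
    simpa using hJ.norm_sub_le hFc hJm hJb D 0
  have hE : ∀ t : ℝ, 0 ≤ t →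
      energy τ F (u t) (H t) ≤ lam * Real.exp (-2 * β * t) * energy τ F (u 0) (H 0) := by
    intro t ht
    simp only [energy_eq]
    rcases ht.eq_or_lt with rfl | ht
    · rw [mul_zero, Real.exp_zero, mul_one]
      exact le_mul_of_one_le_left (by positivity) hlam1
    · have key := hsol.weighted_energy_le hτ (by linarith) hcl hβ.le hβP hβτ hPoinc
        (fun D => hmono (min_le_right _ _) (hFω D)) hLip
        (hH₀.mono fun x hx => hmono (min_le_left _ _) hx) ht
      have h1 : ‖u t‖ ^ 2 ≤ lam * ‖u t‖ ^ 2 := le_mul_of_one_le_left (sq_nonneg _) hlam1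
      have h2 : τ * ‖deviation F (H 0)‖ ^ 2 ≤ lam * (τ * ‖deviation F (H 0)‖ ^ 2) :=
        le_mul_of_one_le_left (by positivity) hlam1
      have h3 : Real.exp (-(2 * β) * t) * (lam * ‖u 0‖ ^ 2 + τ * ‖deviation F (H 0)‖ ^ 2) ≤
          Real.exp (-(2 * β) * t) * (lam * (‖u 0‖ ^ 2 + τ * ‖deviation F (H 0)‖ ^ 2)) := by
        gcongr; linarith
      have h4 : -2 * β * t = -(2 * β) * t := by ring
      rw [h4]
      linarith
  have hlim : Tendsto (fun t : ℝ => lam * Real.exp (-2 * β * t) * energy τ F (u 0) (H 0)) atTop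
      (𝓝 0) := by
    have h1 : Tendsto (fun t : ℝ => Real.exp (-2 * β * t)) atTop (𝓝 0) :=
      Real.tendsto_exp_atBot.comp (tendsto_id.const_mul_atTop_of_neg (by linarith))
    simpa using (h1.const_mul lam).mul_const (energy τ F (u 0) (H 0))
  have hE0 : Tendsto (fun t => energy τ F (u t) (H t)) atTop (𝓝 0) := by
    refine squeeze_zero' (Eventually.of_forall fun t => ?_)
      ((eventually_ge_atTop 0).mono fun t ht => hE t ht) hlim
    rw [energy_eq]; positivity
  have hsqrt : ∀ {X : Type} [NormedAddCommGroup X] (f : ℝ → X) (K : ℝ),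
      (∀ t, ‖f t‖ ^ 2 ≤ K * energy τ F (u t) (H t)) → Tendsto f atTop (𝓝 0) := by
    intro X _ f K hf
    rw [tendsto_zero_iff_norm_tendsto_zero]
    have h1 : Tendsto (fun t => ‖f t‖ ^ 2) atTop (𝓝 0) :=
      squeeze_zero (fun t => sq_nonneg _) hf (by simpa using hE0.const_mul K)
    simpa [Real.sqrt_sq (norm_nonneg _)] using h1.sqrt
  refine ⟨hE, hsqrt u 2 fun t => ?_, ?_⟩
  · rw [energy_eq]
    have : 0 ≤ τ / 2 * ‖deviation F (H t)‖ ^ 2 := by positivity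
    linarith
  · have hdev := hsqrt (fun t => deviation F (H t)) (2 / τ) fun t => by
      rw [energy_eq]
      have : 2 / τ * (1 / 2 * ‖u t‖ ^ 2 + τ / 2 * ‖deviation F (H t)‖ ^ 2) =
          1 / τ * ‖u t‖ ^ 2 + ‖deviation F (H t)‖ ^ 2 := by field_simp
      rw [this]
      have : 0 ≤ 1 / τ * ‖u t‖ ^ 2 := by positivity
      linarith
    have henorm := (continuous_enorm.tendsto (0 : Lp (Tensor k d) 2 G.vol)).comp hdev
    simp only [enorm_zero] at henorm
    refine henorm.congr fun t => ?_
    simp only [Function.comp_apply, Lp.enorm_def]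
    exact eLpNorm_congr_ae (coeFn_deviation F (H t))
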